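/- \textbf{Setting.} Let $P=\{x\in\mathbb R^n : l_j(x)>0,\ j=1,\dots,N\}$, $l_j(x)=v_j\cdot x+\lambda_j$, be a nonempty bounded open Delzant polytope: the $v_j\in\mathbb Z^n$ are primitive, $\lambda_j\in\mathbb R$, each $l_j$ cuts out a facet (distinct $j$ giving distinct facets), and at every vertex of $\overline P$ the normals $v_j$ of the facets through it form a basis of $\mathbb Z^n$. Let $\alpha>0$ and let $\tau\in P$ satisfy $1-\alpha l_j(\tau)>0$ for all $j$. Put $\beta_j=\alpha l_j(\tau)$, let $c\in\mathbb R^n$ be the vector with $\tau=\int_P xe^{c\cdot x}dx\big/\int_P e^{c\cdot x}dx$, and set $$\hat u(x)=\sum_{j=1}^N\frac{l_j(x)\log l_j(x)}{\beta_j}\quad(x\in P),\qquad \hat\varphi(\rho)=\sup_{x\in P}\bigl(x\cdot\rho-\hat u(x)\bigr)\quad(\rho\in\mathbb R^n).$$ For $s\in(0,\alpha)$, a solution $\varphi_s$ of the continuity path at $s$ is a function $\varphi_s\in C^\infty(\mathbb R^n)$ with $\nabla^2\varphi_s>0$, $\nabla\varphi_s(\mathbb R^n)=P$, $$\det\nabla^2\varphi_s=\exp\bigl(-s(\varphi_s-\tau\cdot\rho)-(\alpha-s)(\hat\varphi-\tau\cdot\rho)-c\cdot\nabla\varphi_s\bigr),$$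 whose Legendre transform satisfies $\sup_{\rho\in\mathbb R^n}(x\cdot\rho-\varphi_s(\rho))=\hat u(x)+f(x)$ for $x\in P$, with some $f\in C^\infty(\overline P)$. \textbf{Proposition.} (i) For all $P,\alpha,\tau$ as above there is a finite constant $\Lambda$ with $$\sup_{\rho\in\mathbb R^n}|\nabla g_j(\rho)|\le\Lambda\ \text{ for all } j,\qquad g_j(\rho)=\log\bigl(l_j(\nabla\hat\varphi(\rho))\bigr).\tag{1}$$ (ii) Let $n$, $s_0>0$, $\delta>0$ and $\nu,\sigma,\Lambda,L\in\mathbb R$ be given. There is a constant $C=C(n,s_0,\nu,\sigma,\Lambda,L,\delta)$ such that for all $N$ and all $P,\alpha,\tau,c$ as above with $\alpha>s_0$, (1), and $$\nu^{-1}<\mathrm{Vol}(P)<\nu,\quad \sigma^{-1}<\mathrm{diam}(P)<\sigma,\quad \sup_{x\in P}|x|\le\sigma,\quad \sup_{j}\sup_{P}|l_j|\le L,\quad \min_j l_j(\tau)\ge\delta,$$ every $s\in[s_0,\alpha)$ and every solution $\varphi_s$ at $s$ satisfy $$|\varphi_s(\rho)-\hat\varphi(\rho)|\le C\qquad\text{for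 all }\rho\in\mathbb R^n .$$ (The condition $\sup_P|x|\le\sigma$ is automatic when $0\in\overline P$.) -/

import Mathlib

open MeasureTheory
open scoped ContDiff RealInnerProductSpace

noncomputable section

namespace ToricMA

/-- The facet data of a bounded Delzant polytope in `ℝⁿ` with `N` facets: primitive integral inner
normals `v j` and real constants `lam j`. The polytope is the open set where all the affine
functions `l j x = v j · x + lam j` are positive. -/
structure DelzantPolytope (n N : ℕ) where
  v : Fin N → Fin n → ℤ
  lam : Fin N → ℝ
  primitive : ∀ j, Finset.univ.gcd (v j) = 1
  nonempty : {x : EuclideanSpace ℝ (Fin n) |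
    ∀ j, 0 < (∑ i, (v j i : ℝ) * x i) + lam j}.Nonempty
  bounded : Bornology.IsBounded {x : EuclideanSpace ℝ (Fin n) |
    ∀ j, 0 < (∑ i, (v j i : ℝ) * x i) + lam j}
  /-- Every `l j` cuts out a facet, and different indices give different facets. -/
  facet : ∀ j, ∃ x : EuclideanSpace ℝ (Fin n), (∑ i, (v j i : ℝ) * x i) + lam j = 0 ∧
    ∀ k, k ≠ j → 0 < (∑ i, (v k i : ℝ) * x i) + lam k
  /-- At every vertex the normals of the facets through it form a basis of the lattice `ℤⁿ`. -/
  delzant : ∀ p ∈ Set.extremePoints ℝ {x : EuclideanSpace ℝ (Fin n) |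
      ∀ j, 0 ≤ (∑ i, (v j i : ℝ) * x i) + lam j},
    LinearIndependent ℤ
      (fun j : {j : Fin N // (∑ i, (v j i : ℝ) * p i) + lam j = 0} => v j) ∧
    Submodule.span ℤ (v '' {j | (∑ i, (v j i : ℝ) * p i) + lam j = 0}) = ⊤

namespace DelzantPolytope

variable {n N : ℕ} (P : DelzantPolytope n N)

/-- The affine function `l j x = v j · x + lam j`. -/
def l (j : Fin N) (x : EuclideanSpace ℝ (Fin n)) : ℝ :=
  (∑ i, (P.v j i : ℝ) * x i) + P.lam j

/-- The open polytope. -/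
def carrier : Set (EuclideanSpace ℝ (Fin n)) := {x | ∀ j, 0 < P.l j x}

/-- The cone angle parameters `β j = α * l j τ`. -/
def beta (α : ℝ) (τ : EuclideanSpace ℝ (Fin n)) (j : Fin N) : ℝ := α * P.l j τ

/-- The reference symplectic potential `∑ j, l j x * log (l j x) / β j`. -/
def refSymplectic (β : Fin N → ℝ) (x : EuclideanSpace ℝ (Fin n)) : ℝ :=
  ∑ j, P.l j x * Real.log (P.l j x) / β j

/-- The reference Kähler potential, the Legendre transform of the reference symplectic
potential. -/
def refPotential (β : Fin N → ℝ) (ρ : EuclideanSpace ℝ (Fin n)) : ℝ :=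
  ⨆ x : P.carrier, (⟪(x : EuclideanSpace ℝ (Fin n)), ρ⟫ - P.refSymplectic β x)

/-- `Λ` bounds the gradients of all the functions `ρ ↦ log (l j (∇ φhat ρ))`. -/
def IsGradientBound (β : Fin N → ℝ) (Λ : ℝ) : Prop :=
  ∀ (j : Fin N) (ρ : EuclideanSpace ℝ (Fin n)),
    ‖gradient (fun ρ' => Real.log (P.l j (gradient (P.refPotential β) ρ'))) ρ‖ ≤ Λ

/-- `τ` is the barycenter of the polytope for the density `exp (c · x)`. -/
def IsCompatible (τ c : EuclideanSpace ℝ (Fin n)) : Prop :=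
  τ = (∫ x in P.carrier, Real.exp ⟪c, x⟫)⁻¹ • ∫ x in P.carrier, Real.exp ⟪c, x⟫ • x

end DelzantPolytope

/-- The Hessian matrix of `φ` at `ρ` in the standard coordinates. -/
def hessian {n : ℕ} (φ : EuclideanSpace ℝ (Fin n) → ℝ) (ρ : EuclideanSpace ℝ (Fin n)) :
    Matrix (Fin n) (Fin n) ℝ :=
  Matrix.of fun i j =>
    fderiv ℝ (fun y => fderiv ℝ φ y (EuclideanSpace.single i 1)) ρ (EuclideanSpace.single j 1)

/-- `φ` solves the equation of the continuity path at the parameter `s`. -/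
structure IsSolution {n N : ℕ} (P : DelzantPolytope n N) (α : ℝ)
    (τ c : EuclideanSpace ℝ (Fin n)) (s : ℝ) (φ : EuclideanSpace ℝ (Fin n) → ℝ) : Prop where
  smooth : ContDiff ℝ ∞ φ
  convex : ∀ ρ, (hessian φ ρ).PosDef
  gradient_range : Set.range (gradient φ) = P.carrier
  monge_ampere : ∀ ρ, (hessian φ ρ).det =
    Real.exp (-s * (φ ρ - ⟪τ, ρ⟫)
      - (α - s) * (P.refPotential (P.beta α τ) ρ - ⟪τ, ρ⟫) - ⟪c, gradient φ ρ⟫)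
  /-- On the polytope the Legendre transform of `φ` is the reference symplectic potential plus a
  function that is smooth up to the boundary. -/
  guillemin : ∃ f : EuclideanSpace ℝ (Fin n) → ℝ, ContDiff ℝ ∞ f ∧
    ∀ x ∈ P.carrier, IsLUB (Set.range fun ρ : EuclideanSpace ℝ (Fin n) => ⟪x, ρ⟫ - φ ρ)
      (P.refSymplectic (P.beta α τ) x + f x)

end ToricMA

end

/-!
# Uniform estimate for the continuity path of toric Monge-Ampère equations

The reference symplectic potential `û = ∑ j, l j * log (l j) / β j` is strictly convex with slope
`-∞` at the facets, so its gradient is a diffeomorphism from the polytope `P` onto `ℝⁿ`. The inverse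
`X` (`refMoment`) is the gradient of the reference potential `φhat`. The gradient of `log (l j (X
ρ))` solves a least squares problem for the normals with weights `1 / (β k * l k)`, and the
solutions of such problems are bounded uniformly over all positive weights
(`exists_norm_le_of_normal_equation`). This is the gradient bound.

For the estimate, let `W = s (φ - τ · ρ) + (α - s) (φhat - τ · ρ)`, so that the equation reads `det
D²φ = exp (-W - c · ∇φ)`. All data are controlled by the given constants: thin slabs have small
volume, which bounds the normals, hence the number of facets and the distance of `τ` to the
boundary, and then the barycenter condition bounds `c` (`exists_isControlled`).

* The function `W` is convex with bounded gradient, `det D²W ≥ sⁿ det D²φ ≥ c₀ exp (-W)`, and `exp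
  (-W)` has the mass of `exp (c · x)` on `P`. The image of `exp (-W)` under `∇W` thus has bounded
  density and gives little mass to thin slabs, while integration by parts gives `∇W` mean zero and
  `∇W · (ρ - ρ₀)` mean `n`, where `ρ₀` is the minimum of `W`. So in every direction some tangent to
  `W` with controlled value at `ρ₀` has a definite slope, that is, `W ≥ ε |ρ - ρ₀| - C`. Comparing
  with the mass, also `|W ρ₀| ≤ C` (`exists_linear_growth`).
* As `∇φ - τ` has mean zero by the change of variables and the barycenter condition, so has `X - τ`,
  that is, `l j (X ρ)` has mean `l j τ ≥ δ`. Since `exp (-W)` is concentrated near `ρ₀` and `log (l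
  j (X ρ))` is Lipschitz, `l j (X ρ₀)` is bounded below. Hence `ρ₀`, which is `∇û` at `X ρ₀`, is
  bounded, and so is `φ 0` (`exists_path_growth`).
* The upper bound for `φ - φhat` now follows from convexity. The lower bound is an upper bound for
  the Legendre transform of `φ`. The gradient image of `{R < |ρ|}` is exponentially small, so a
  chain `x + 2⁻ᵏ (z - x)` of points can be chosen along which the gradient of the transform grows at
  most linearly in `k`, and the increments along the chain are summable (`exists_legendre_le`).
-/

namespace ToricMA

/-! ### Convexity inequalities -/

theorem mul_log_add_le_mul_log {a b : ℝ} (ha : 0 < a) (hb : 0 < b) :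
    a * Real.log a + (1 + Real.log a) * (b - a) ≤ b * Real.log b := by
  have h := Real.log_le_sub_one_of_pos (div_pos ha hb)
  rw [Real.log_div ha.ne' hb.ne'] at h
  have h2 := mul_le_mul_of_nonneg_left h hb.le
  have h3 : b * (a / b - 1) = a - b := by field_simp
  rw [h3] at h2
  nlinarith

theorem abs_mul_log_le {t L : ℝ} (ht : 0 < t) (htL : t ≤ L) : |t * Real.log t| ≤ 1 + L ^ 2 := by
  have h1 := mul_log_add_le_mul_log one_pos ht
  have h2 := mul_le_mul_of_nonneg_left (Real.log_le_sub_one_of_pos ht) ht.le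
  rw [Real.log_one] at h1
  rw [abs_le]
  constructor <;> nlinarith [sq_nonneg (L - 1), mul_self_nonneg (L - t)]

theorem abs_inner_sub_le {F : Type*} [NormedAddCommGroup F] [InnerProductSpace ℝ F] (b ρ₀ ρ : F) :
    |⟪b, ρ - ρ₀⟫| ≤ ‖b‖ * (1 + ‖ρ₀‖) * (1 + ‖ρ‖) := by
  refine (abs_real_inner_le_norm _ _).trans ?_
  have h1 := norm_sub_le ρ ρ₀
  have h2 : ‖ρ - ρ₀‖ ≤ (1 + ‖ρ₀‖) * (1 + ‖ρ‖) := by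
    nlinarith [mul_nonneg (norm_nonneg ρ) (norm_nonneg ρ₀)]
  rw [mul_assoc]
  gcongr

/-- A function with a continuous field of subgradients is differentiable. -/
theorem hasGradientAt_of_subgradient {E : Type*} [NormedAddCommGroup E] [InnerProductSpace ℝ E]
    [CompleteSpace E] {f : E → ℝ} {g : E → E} (hsub : ∀ x y, f x + ⟪g x, y - x⟫ ≤ f y) {x : E}
    (hg : ContinuousAt g x) : HasGradientAt f (g x) x := by
  rw [hasGradientAt_iff_isLittleO]
  rw [Asymptotics.isLittleO_iff]
  intro c hc
  have h1 : ∀ᶠ y in nhds x, ‖g y - g x‖ < c := by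
    simpa only [dist_eq_norm] using Metric.continuousAt_iff'.mp hg c hc
  filter_upwards [h1] with y hy
  have h2 := hsub x y
  have h3 := hsub y x
  have h4 : ⟪g y, x - y⟫ = -⟪g y, y - x⟫ := by rw [← neg_sub y x, inner_neg_right]
  have h5 : ⟪g y, y - x⟫ = ⟪g x, y - x⟫ + ⟪g y - g x, y - x⟫ := by
    rw [inner_sub_left]; ring
  have h6 := real_inner_le_norm (g y - g x) (y - x)
  have h7 : ‖g y - g x‖ * ‖y - x‖ ≤ c * ‖y - x‖ := by gcongr
  rw [Real.norm_eq_abs, abs_of_nonneg (by linarith)]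
  linarith

/-- A function with a monotone gradient lies above its tangents. -/
theorem add_inner_le_of_monotone_gradient {E : Type*} [NormedAddCommGroup E]
    [InnerProductSpace ℝ E] [CompleteSpace E] {f : E → ℝ} {g : E → E}
    (hf : ∀ x, HasGradientAt f (g x) x) (hmono : ∀ x y, 0 ≤ ⟪g y - g x, y - x⟫) (x y : E) :
    f x + ⟪g x, y - x⟫ ≤ f y := by
  have hder : ∀ t : ℝ, HasDerivAt (fun t : ℝ => f (x + t • (y - x)))
      ⟪g (x + t • (y - x)), y - x⟫ t := by
    intro t
    have h1 : HasDerivAt (fun t : ℝ => x + t • (y - x)) (y - x) t := by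
      simpa using ((hasDerivAt_id t).smul_const (y - x)).const_add x
    exact ((hf (x + t • (y - x))).hasFDerivAt.comp_hasDerivAt t h1).congr_deriv (by simp)
  obtain ⟨t, ht, hslope⟩ := exists_hasDerivAt_eq_slope (fun t : ℝ => f (x + t • (y - x)))
    (fun t => ⟪g (x + t • (y - x)), y - x⟫) zero_lt_one
    (fun t _ => (hder t).continuousAt.continuousWithinAt) (fun t _ => hder t)
  have h2 := hmono x (x + t • (y - x))
  rw [add_sub_cancel_left, inner_smul_right, inner_sub_left] at h2
  have h3 := nonneg_of_mul_nonneg_right h2 ht.1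
  simp only [one_smul, zero_smul, add_zero, sub_zero, div_one, add_sub_cancel] at hslope
  linarith

/-- A vector field with a pointwise positive definite derivative is strictly monotone. -/
theorem inner_sub_pos_of_fderiv_pos {E : Type*} [NormedAddCommGroup E]
    [InnerProductSpace ℝ E] {g : E → E} {A : E → E →L[ℝ] E} (hg : ∀ x, HasFDerivAt g (A x) x)
    (hpos : ∀ x w, w ≠ 0 → 0 < ⟪A x w, w⟫) {x y : E} (hxy : x ≠ y) :
    0 < ⟪g y - g x, y - x⟫ := by
  have hder : ∀ t : ℝ, HasDerivAt (fun t : ℝ => ⟪g (x + t • (y - x)), y - x⟫)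
      ⟪A (x + t • (y - x)) (y - x), y - x⟫ t := by
    intro t
    have h1 : HasDerivAt (fun t : ℝ => x + t • (y - x)) (y - x) t := by
      simpa using ((hasDerivAt_id t).smul_const (y - x)).const_add x
    have h2 := ((hg (x + t • (y - x))).comp_hasDerivAt t h1).inner ℝ
      (hasDerivAt_const t (y - x))
    simpa using h2
  have hmono : StrictMono fun t : ℝ => ⟪g (x + t • (y - x)), y - x⟫ :=
    strictMono_of_hasDerivAt_pos hder fun t => hpos _ _ (sub_ne_zero.mpr hxy.symm)
  have h := hmono zero_lt_one
  simp only [one_smul, zero_smul, add_zero, add_sub_cancel] at h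
  rw [inner_sub_left]
  linarith

/-! ### Determinants of sums of positive matrices -/

section Det

variable {m : Type*} [Fintype m] [DecidableEq m]

theorem one_le_det_one_add_of_posSemidef {B : Matrix m m ℝ} (hB : B.PosSemidef) :
    1 ≤ (1 + B).det := by
  have hH : (1 + B).IsHermitian := Matrix.isHermitian_one.add hB.1
  rw [hH.det_eq_prod_eigenvalues]
  refine Finset.one_le_prod fun i _ => ?_
  have h := hH.eigenvalues_eq i
  set x := (hH.eigenvectorBasis i).ofLp with hx
  have hn : star x ⬝ᵥ x = 1 := by
    have h1 := hH.eigenvectorBasis.orthonormal.1 i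
    have h2 : inner ℝ (hH.eigenvectorBasis i) (hH.eigenvectorBasis i) = 1 := by
      rw [real_inner_self_eq_norm_sq, h1]; norm_num
    rw [EuclideanSpace.inner_eq_star_dotProduct] at h2
    rw [← h2, dotProduct_comm]
  have h3 : 0 ≤ star x ⬝ᵥ B.mulVec x := hB.dotProduct_mulVec_nonneg x
  rw [Matrix.add_mulVec, Matrix.one_mulVec, dotProduct_add, hn] at h
  simp only [RCLike.re_to_real] at h
  simp only [RCLike.ofReal_real_eq_id, id_eq]
  rw [h]
  exact le_add_of_nonneg_right h3

open scoped MatrixOrder in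
theorem det_le_det_add_of_posSemidef {A B : Matrix m m ℝ} (hA : A.PosDef) (hB : B.PosSemidef) :
    A.det ≤ (A + B).det := by
  -- Write `A = Sᴴ S` and conjugate by `S` to reduce to `A = 1`.
  obtain ⟨S, hS⟩ := CStarAlgebra.nonneg_iff_eq_star_mul_self.mp hA.posSemidef.nonneg
  rw [Matrix.star_eq_conjTranspose] at hS
  have hdet : A.det = S.det * S.det := by
    rw [hS, Matrix.det_mul, Matrix.det_conjTranspose]; simp
  have hSu : IsUnit S.det := by
    have h0 := hA.det_pos
    rw [isUnit_iff_ne_zero]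
    rintro h
    rw [hdet, h] at h0
    simp at h0
  have key : A + B = S.conjTranspose * (1 + (S⁻¹).conjTranspose * B * S⁻¹) * S := by
    have h1 : S⁻¹ * S = 1 := Matrix.nonsing_inv_mul S hSu
    have h2 : S.conjTranspose * (S⁻¹).conjTranspose = 1 := by
      rw [← Matrix.conjTranspose_mul, h1, Matrix.conjTranspose_one]
    calc A + B = S.conjTranspose * S
          + (S.conjTranspose * (S⁻¹).conjTranspose) * B * (S⁻¹ * S) := by
          rw [h1, h2, ← hS]; simp
      _ = _ := by noncomm_ring
  have h3 := one_le_det_one_add_of_posSemidef (hB.conjTranspose_mul_mul_same S⁻¹)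
  rw [key, Matrix.det_mul, Matrix.det_mul, Matrix.det_conjTranspose, hdet]
  simp only [star_trivial]
  nlinarith [mul_self_nonneg S.det]

end Det

/-! ### Weighted least squares -/

section WeightedLeastSquares

variable {E : Type*} [NormedAddCommGroup E] [InnerProductSpace ℝ E] [FiniteDimensional ℝ E]

/-- The solutions of all weighted least squares problems `⟪v k, w⟫ ≈ b k` with positive weights form
a bounded set. If they were unbounded, then along a limit direction `d` the residuals would
eventually have the signs of `⟪v k, d⟫`, which contradicts the normal equation. -/
theorem exists_norm_le_of_normal_equation {ι : Type*} [Fintype ι] (v : ι → E) (b : ι → ℝ)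
    (hv : ∀ w : E, (∀ k, ⟪v k, w⟫ = 0) → w = 0) :
    ∃ Λ : ℝ, ∀ (a : ι → ℝ) (w : E), (∀ k, 0 < a k) →
      ∑ k, (a k * (⟪v k, w⟫ - b k)) • v k = 0 → ‖w‖ ≤ Λ := by
  by_contra! hcon
  choose a w ha heq hw using fun m : ℕ => hcon (m + 1 : ℝ)
  have hpos : ∀ m, 0 < ‖w m‖ := fun m => lt_trans (by positivity) (hw m)
  have hmem : ∀ m, ‖w m‖⁻¹ • w m ∈ Metric.sphere (0 : E) 1 := fun m => by
    simp [norm_smul, (hpos m).ne']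
  obtain ⟨d, hd, ψ, hψ, hlim⟩ := (isCompact_sphere (0 : E) 1).tendsto_subseq hmem
  have hd1 : ‖d‖ = 1 := by simpa using hd
  have hinv : Filter.Tendsto (fun m => ‖w (ψ m)‖⁻¹) Filter.atTop (nhds 0) := by
    refine Filter.Tendsto.inv_tendsto_atTop ?_
    refine Filter.tendsto_atTop_mono (fun m => ?_) tendsto_natCast_atTop_atTop
    have h1 : m ≤ ψ m := hψ.id_le m
    have h2 : (m : ℝ) ≤ ψ m := by exact_mod_cast h1
    linarith [hw (ψ m)]
  -- Eventually each residual has the sign of `⟪v k, d⟫`, unless the latter is zero.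
  have hk : ∀ k, ∀ᶠ m in Filter.atTop, ⟪v k, d⟫ ≠ 0 →
      0 < (⟪v k, w (ψ m)⟫ - b k) * ⟪v k, d⟫ := by
    intro k
    by_cases h0 : ⟪v k, d⟫ = 0
    · simp [h0]
    have hl : Filter.Tendsto
        (fun m => (⟪v k, ‖w (ψ m)‖⁻¹ • w (ψ m)⟫ - ‖w (ψ m)‖⁻¹ * b k) * ⟪v k, d⟫) Filter.atTop
        (nhds ((⟪v k, d⟫ - 0 * b k) * ⟪v k, d⟫)) :=
      (((tendsto_const_nhds.inner hlim).sub (hinv.mul_const _)).mul_const _)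
    have hp : 0 < (⟪v k, d⟫ - 0 * b k) * ⟪v k, d⟫ := by
      have := mul_self_pos.mpr h0
      simpa using this
    filter_upwards [hl.eventually (lt_mem_nhds hp)] with m hm _
    rw [inner_smul_right, ← mul_sub, mul_assoc] at hm
    exact (pos_iff_pos_of_mul_pos hm).mp (inv_pos.mpr (hpos _))
  obtain ⟨m, hm⟩ := (Filter.eventually_all.mpr hk).exists
  have h0 := congrArg (fun y => ⟪y, d⟫) (heq (ψ m))
  simp only [sum_inner, inner_smul_left, inner_zero_left, RCLike.conj_to_real] at h0
  have hnn : ∀ k ∈ Finset.univ,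
      0 ≤ a (ψ m) k * (⟪v k, w (ψ m)⟫ - b k) * ⟪v k, d⟫ := by
    intro k _
    by_cases hz : ⟪v k, d⟫ = 0
    · simp [hz]
    · rw [mul_assoc]; exact (mul_pos (ha _ k) (hm k hz)).le
  rw [Finset.sum_eq_zero_iff_of_nonneg hnn] at h0
  have hd0 : d = 0 := by
    refine hv d fun k => ?_
    by_contra hz
    have h1 := h0 k (Finset.mem_univ k)
    rw [mul_assoc] at h1
    exact (mul_pos (ha _ k) (hm k hz)).ne' h1
  rw [hd0, norm_zero] at hd1
  exact zero_ne_one hd1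

end WeightedLeastSquares

/-! ### Volume of slabs and integrals of exponentials -/

section Volume

variable {E : Type*} [NormedAddCommGroup E] [InnerProductSpace ℝ E] [FiniteDimensional ℝ E]
  [MeasurableSpace E] [BorelSpace E]

/-- Stretching a slab of half-width `κ` by the factor `M / κ` in the direction `θ` maps it into a
ball of radius `2 * M`. -/
theorem volume_le_of_subset_slab {S : Set E} {M κ a : ℝ} {θ : E} (hM : 0 < M) (hκ : 0 < κ)
    (hθ : ‖θ‖ = 1) (hS : ∀ y ∈ S, ‖y‖ ≤ M ∧ |⟪θ, y⟫ - a| ≤ κ) :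
    volume S ≤ ENNReal.ofReal (κ / M) * volume (Metric.closedBall (0 : E) (2 * M)) := by
  set f : Module.Dual ℝ E := (innerSL ℝ θ).toLinearMap with hf
  have hθθ : ⟪θ, θ⟫ = (1 : ℝ) := by rw [real_inner_self_eq_norm_sq, hθ]; norm_num
  set T : E →ₗ[ℝ] E := LinearMap.transvection f ((M / κ - 1) • θ) with hT
  have hTy : ∀ y, T y = y + (⟪θ, y⟫ * (M / κ - 1)) • θ := fun y => by
    simp [hT, hf, LinearMap.transvection.apply, smul_smul]
  have hdet : LinearMap.det T = M / κ := by
    rw [hT, LinearMap.transvection.det]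
    simp [hf, hθ]
  have hpos : 0 < M / κ := div_pos hM hκ
  have himg : T '' S ⊆ Metric.closedBall ((M / κ * a) • θ) (2 * M) := by
    rintro _ ⟨y, hy, rfl⟩
    obtain ⟨h1, h2⟩ := hS y hy
    rw [mem_closedBall_iff_norm]
    have h3 : T y - (M / κ * a) • θ = (y - ⟪θ, y⟫ • θ) + (M / κ * (⟪θ, y⟫ - a)) • θ := by
      rw [hTy]; module
    have h4 : ‖y - ⟪θ, y⟫ • θ‖ ≤ ‖y‖ := by
      refine abs_le_of_sq_le_sq' ?_ (norm_nonneg y) |>.2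
      rw [← real_inner_self_eq_norm_sq, ← real_inner_self_eq_norm_sq]
      simp only [inner_sub_left, inner_sub_right, inner_smul_left, inner_smul_right, hθθ,
        real_inner_comm θ y, RCLike.conj_to_real]
      nlinarith [mul_self_nonneg ⟪θ, y⟫]
    have h5 : ‖(M / κ * (⟪θ, y⟫ - a)) • θ‖ ≤ M := by
      rw [norm_smul, hθ, mul_one, Real.norm_eq_abs, abs_mul, abs_of_pos hpos]
      calc M / κ * |⟪θ, y⟫ - a| ≤ M / κ * κ := by gcongr
        _ = M := by field_simp
    calc ‖T y - (M / κ * a) • θ‖ ≤ _ := h3 ▸ norm_add_le _ _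
      _ ≤ 2 * M := by linarith
  have h6 := measure_mono (μ := volume) himg
  rw [Measure.addHaar_image_linearMap, hdet, abs_of_pos hpos,
    Measure.addHaar_closedBall_center] at h6
  calc volume S = ENNReal.ofReal (κ / M) * (ENNReal.ofReal (M / κ) * volume S) := by
        rw [← mul_assoc, ← ENNReal.ofReal_mul (by positivity)]
        have : κ / M * (M / κ) = 1 := by field_simp
        rw [this, ENNReal.ofReal_one, one_mul]
    _ ≤ _ := by gcongr

theorem integrable_exp_neg_mul_norm {a : ℝ} (ha : 0 < a) :
    Integrable (fun x : E => Real.exp (-(a * ‖x‖))) := by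
  set r : ℕ := Module.finrank ℝ E + 1 with hr
  have h1 : Integrable (fun x : E => (1 + ‖x‖) ^ (-(r : ℝ))) :=
    integrable_one_add_norm (by rw [hr]; push_cast; linarith)
  set C : ℝ := (r.factorial : ℝ) / a ^ r * Real.exp a with hC
  refine (h1.const_mul C).mono' (by fun_prop) (Filter.Eventually.of_forall fun x => ?_)
  rw [Real.norm_eq_abs, abs_of_pos (Real.exp_pos _)]
  have h2 : (a * (1 + ‖x‖)) ^ r / r.factorial ≤ Real.exp (a * (1 + ‖x‖)) :=
    Real.pow_div_factorial_le_exp _ (by positivity) r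
  have h3 : 0 < 1 + ‖x‖ := by positivity
  have e : Real.exp (a * (1 + ‖x‖)) = Real.exp a * Real.exp (a * ‖x‖) := by
    rw [← Real.exp_add]; ring_nf
  rw [e, mul_pow, div_le_iff₀ (by positivity)] at h2
  rw [Real.rpow_neg h3.le, Real.rpow_natCast, hC, Real.exp_neg,
    inv_le_iff_one_le_mul₀ (Real.exp_pos _)]
  field_simp
  rw [mul_comm ‖x‖ a]
  linarith

theorem integrable_exp_neg_mul_norm_sub {a : ℝ} (ha : 0 < a) (c : E) :
    Integrable (fun x : E => Real.exp (-(a * ‖x - c‖))) :=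
  (integrable_exp_neg_mul_norm ha).comp_sub_right c

theorem integral_exp_neg_mul_norm_pos {a : ℝ} (ha : 0 < a) :
    0 < ∫ x : E, Real.exp (-(a * ‖x‖)) :=
  integral_exp_pos (integrable_exp_neg_mul_norm ha)

theorem setIntegral_exp_neg_mul_norm_le {a R : ℝ} (ha : 0 < a) (c : E) :
    ∫ x in {x : E | R < ‖x - c‖}, Real.exp (-(a * ‖x - c‖)) ≤
      Real.exp (-(a / 2 * R)) * ∫ x : E, Real.exp (-(a / 2 * ‖x‖)) := by
  have ha2 : 0 < a / 2 := by positivity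
  rw [← integral_sub_right_eq_self (fun x : E => Real.exp (-(a / 2 * ‖x‖))) c,
    ← integral_const_mul]
  have hm : MeasurableSet {x : E | R < ‖x - c‖} := measurableSet_lt (by fun_prop) (by fun_prop)
  have hi := (integrable_exp_neg_mul_norm_sub ha2 c).const_mul (Real.exp (-(a / 2 * R)))
  calc _ ≤ ∫ x in {x : E | R < ‖x - c‖},
        Real.exp (-(a / 2 * R)) * Real.exp (-(a / 2 * ‖x - c‖)) := by
        refine setIntegral_mono_on (integrable_exp_neg_mul_norm_sub ha c).integrableOn
          hi.integrableOn hm fun x hx => ?_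
        rw [← Real.exp_add, Real.exp_le_exp]
        have : R < ‖x - c‖ := hx
        nlinarith
    _ ≤ _ := setIntegral_le_integral hi (Filter.Eventually.of_forall fun x => by positivity)

end Volume

namespace DelzantPolytope

/-! ### The reference potential -/

variable {n N : ℕ} (P : DelzantPolytope n N)

/-- The inner normal of the `j`-th facet as a vector of Euclidean space. -/
noncomputable def normal (j : Fin N) : EuclideanSpace ℝ (Fin n) :=
  WithLp.toLp 2 fun i => (P.v j i : ℝ)

theorem l_eq_inner (j : Fin N) (x : EuclideanSpace ℝ (Fin n)) :
    P.l j x = ⟪P.normal j, x⟫ + P.lam j := by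
  simp [l, normal, PiLp.inner_apply, mul_comm]

theorem l_sub (j : Fin N) (x y : EuclideanSpace ℝ (Fin n)) :
    P.l j y - P.l j x = ⟪P.normal j, y - x⟫ := by
  rw [l_eq_inner, l_eq_inner, inner_sub_right]; ring

theorem l_lineMap (j : Fin N) (x z : EuclideanSpace ℝ (Fin n)) (t : ℝ) :
    P.l j (x + t • (z - x)) = (1 - t) * P.l j x + t * P.l j z := by
  simp only [l_eq_inner, inner_add_right, inner_smul_right, inner_sub_right]; ring

theorem continuous_l (j : Fin N) : Continuous (P.l j) := by
  have : P.l j = fun x => ⟪P.normal j, x⟫ + P.lam j := funext (P.l_eq_inner j)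
  rw [this]; fun_prop

theorem hasStrictFDerivAt_l (j : Fin N) (x : EuclideanSpace ℝ (Fin n)) :
    HasStrictFDerivAt (P.l j) (innerSL ℝ (P.normal j)) x := by
  have : P.l j = fun x => innerSL ℝ (P.normal j) x + P.lam j := by
    funext y; simp [P.l_eq_inner]
  rw [this]
  exact (innerSL ℝ (P.normal j)).hasStrictFDerivAt.add_const _

theorem carrier_nonempty : P.carrier.Nonempty := P.nonempty

theorem isBounded_carrier : Bornology.IsBounded P.carrier := P.bounded

theorem isOpen_carrier : IsOpen P.carrier := by
  have : P.carrier = ⋂ j, {x | 0 < P.l j x} := by ext x; simp [carrier]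
  rw [this]
  exact isOpen_iInter_of_finite fun j => isOpen_lt continuous_const (P.continuous_l j)

theorem convex_carrier : Convex ℝ P.carrier := by
  rw [convex_iff_add_mem]
  intro x hx y hy a b ha hb hab j
  have h1 := hx j
  have h2 := hy j
  have h3 : P.l j (a • x + b • y) = a * P.l j x + b * P.l j y := by
    simp only [l_eq_inner, inner_add_right, inner_smul_right]
    linear_combination (-P.lam j) * hab
  rw [h3]
  rcases ha.eq_or_lt with rfl | ha'
  · have : b = 1 := by linarith
    simp [this, h2]
  · have := mul_pos ha' h1
    have := mul_nonneg hb h2.le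
    linarith

/-- The normals span, since otherwise the polytope would contain a line. -/
theorem eq_zero_of_forall_inner_normal_eq_zero {w : EuclideanSpace ℝ (Fin n)}
    (hw : ∀ j, ⟪P.normal j, w⟫ = 0) : w = 0 := by
  obtain ⟨x, hx⟩ := P.carrier_nonempty
  obtain ⟨r, hr⟩ := (Metric.isBounded_iff_subset_closedBall 0).mp P.isBounded_carrier
  by_contra hne
  have hn : 0 < ‖w‖ := norm_pos_iff.mpr hne
  have hmem : ∀ t : ℝ, x + t • w ∈ P.carrier := fun t j => by
    have := hx j
    rw [l_eq_inner] at *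
    rw [inner_add_right, inner_smul_right, hw j]
    simpa using this
  set t := (|r| + ‖x‖ + 1) / ‖w‖ with ht
  have h1 := hr (hmem t)
  rw [mem_closedBall_zero_iff] at h1
  have h2 : ‖t • w‖ = |r| + ‖x‖ + 1 := by
    rw [norm_smul, Real.norm_eq_abs, abs_of_nonneg (by positivity), ht]; field_simp
  have h3 : ‖t • w‖ ≤ ‖x + t • w‖ + ‖x‖ := by
    have := norm_sub_le (x + t • w) x
    simpa using this
  linarith [le_abs_self r]

variable (β : Fin N → ℝ)

/-- The gradient of the reference symplectic potential on the polytope. -/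
noncomputable def gradSymplectic (x : EuclideanSpace ℝ (Fin n)) : EuclideanSpace ℝ (Fin n) :=
  ∑ j, ((1 + Real.log (P.l j x)) / β j) • P.normal j

/-- The Hessian of the reference symplectic potential on the polytope, as a linear map. -/
noncomputable def hessSymplectic (x : EuclideanSpace ℝ (Fin n)) :
    EuclideanSpace ℝ (Fin n) →L[ℝ] EuclideanSpace ℝ (Fin n) :=
  ∑ j, (innerSL ℝ ((β j * P.l j x)⁻¹ • P.normal j)).smulRight (P.normal j)

theorem hessSymplectic_apply (x w : EuclideanSpace ℝ (Fin n)) :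
    P.hessSymplectic β x w = ∑ j, ((β j * P.l j x)⁻¹ * ⟪P.normal j, w⟫) • P.normal j := by
  simp [hessSymplectic]

theorem hasFDerivAt_refSymplectic {x : EuclideanSpace ℝ (Fin n)} (hx : x ∈ P.carrier) :
    HasFDerivAt (P.refSymplectic β) (innerSL ℝ (P.gradSymplectic β x)) x := by
  have h : ∀ j ∈ Finset.univ, HasFDerivAt (fun y => P.l j y * Real.log (P.l j y) / β j)
      (((1 + Real.log (P.l j x)) / β j) • innerSL ℝ (P.normal j)) x := by
    intro j _
    have h1 := ((Real.hasDerivAt_mul_log (hx j).ne').comp_hasFDerivAt x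
      (P.hasStrictFDerivAt_l j x).hasFDerivAt).mul_const (β j)⁻¹
    simp only [div_eq_mul_inv]
    refine h1.congr_fderiv ?_
    ext w
    simp only [smul_apply, smul_eq_mul]
    ring
  have h2 := HasFDerivAt.fun_sum h
  refine h2.congr_fderiv ?_
  ext w
  simp [gradSymplectic]

theorem hasStrictFDerivAt_gradSymplectic {x : EuclideanSpace ℝ (Fin n)} (hx : x ∈ P.carrier) :
    HasStrictFDerivAt (P.gradSymplectic β) (P.hessSymplectic β x) x := by
  have h : ∀ j ∈ Finset.univ,
      HasStrictFDerivAt (fun y => ((1 + Real.log (P.l j y)) / β j) • P.normal j)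
      ((innerSL ℝ ((β j * P.l j x)⁻¹ • P.normal j)).smulRight (P.normal j)) x := by
    intro j _
    have h1 := ((((P.hasStrictFDerivAt_l j x).log (hx j).ne').const_add 1).mul_const
      ((β j)⁻¹)).smul_const (P.normal j)
    simp only [div_eq_mul_inv]
    refine h1.congr_fderiv ?_
    ext w
    simp
    left
    ring
  exact HasStrictFDerivAt.fun_sum h

variable {β}

theorem refSymplectic_add_inner_le (hβ : ∀ j, 0 < β j) {x y : EuclideanSpace ℝ (Fin n)}
    (hx : x ∈ P.carrier) (hy : y ∈ P.carrier) :
    P.refSymplectic β x + ⟪P.gradSymplectic β x, y - x⟫ ≤ P.refSymplectic β y := by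
  simp only [refSymplectic, gradSymplectic, sum_inner, inner_smul_left, RCLike.conj_to_real,
    ← P.l_sub]
  rw [← Finset.sum_add_distrib]
  refine Finset.sum_le_sum fun j _ => ?_
  have h := mul_log_add_le_mul_log (hx j) (hy j)
  have h2 := div_le_div_of_nonneg_right h (hβ j).le
  calc _ = (P.l j x * Real.log (P.l j x) + (1 + Real.log (P.l j x)) * (P.l j y - P.l j x)) / β j :=
        by ring
    _ ≤ _ := h2

theorem injOn_gradSymplectic (hβ : ∀ j, 0 < β j) :
    Set.InjOn (P.gradSymplectic β) P.carrier := by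
  intro x hx y hy hxy
  rw [← sub_eq_zero]
  refine P.eq_zero_of_forall_inner_normal_eq_zero fun j => ?_
  have h0 : ⟪P.gradSymplectic β x - P.gradSymplectic β y, x - y⟫ = 0 := by
    rw [hxy, sub_self, inner_zero_left]
  have hterm : ∀ {a b : ℝ}, 0 < a → 0 < b → 0 ≤ (Real.log a - Real.log b) * (a - b) := by
    intro a b ha hb
    rcases le_total a b with h | h
    · exact mul_nonneg_of_nonpos_of_nonpos (by linarith [Real.log_le_log ha h]) (by linarith)
    · exact mul_nonneg (by linarith [Real.log_le_log hb h]) (by linarith)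
  have h1 : ⟪P.gradSymplectic β x - P.gradSymplectic β y, x - y⟫ =
      ∑ j, (Real.log (P.l j x) - Real.log (P.l j y)) * (P.l j x - P.l j y) / β j := by
    simp only [gradSymplectic, inner_sub_left, sum_inner, inner_smul_left, RCLike.conj_to_real,
      ← P.l_sub]
    rw [← Finset.sum_sub_distrib]
    refine Finset.sum_congr rfl fun j _ => ?_
    ring
  rw [h1, Finset.sum_eq_zero_iff_of_nonneg
    fun j _ => div_nonneg (hterm (hx j) (hy j)) (hβ j).le] at h0
  have h2 := h0 j (Finset.mem_univ j)
  rw [div_eq_zero_iff, or_iff_left (hβ j).ne', mul_eq_zero] at h2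
  rw [← P.l_sub]
  rcases h2 with h2 | h2
  · rw [Real.log_injOn_pos (hx j) (hy j) (by linarith), sub_self]
  · exact h2

theorem inner_hessSymplectic (x w z : EuclideanSpace ℝ (Fin n)) :
    ⟪P.hessSymplectic β x w, z⟫ =
      ∑ j, (β j * P.l j x)⁻¹ * ⟪P.normal j, w⟫ * ⟪P.normal j, z⟫ := by
  simp [hessSymplectic_apply, sum_inner, inner_smul_left]

theorem injective_hessSymplectic (hβ : ∀ j, 0 < β j) {x : EuclideanSpace ℝ (Fin n)}
    (hx : x ∈ P.carrier) : Function.Injective (P.hessSymplectic β x) := by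
  rw [injective_iff_map_eq_zero]
  intro w hw
  refine P.eq_zero_of_forall_inner_normal_eq_zero fun j => ?_
  have hp : ∀ j, 0 < (β j * P.l j x)⁻¹ := fun j => inv_pos.mpr (mul_pos (hβ j) (hx j))
  have h := P.inner_hessSymplectic (β := β) x w w
  rw [hw, inner_zero_left, eq_comm, Finset.sum_eq_zero_iff_of_nonneg fun j _ => by
    rw [mul_assoc]; exact mul_nonneg (hp j).le (mul_self_nonneg _)] at h
  have h2 := h j (Finset.mem_univ j)
  rw [mul_assoc, mul_eq_zero, or_iff_right (hp j).ne'] at h2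
  exact mul_self_eq_zero.mp h2

/-- The Hessian of the reference symplectic potential as a linear equivalence. -/
noncomputable def hessEquiv (hβ : ∀ j, 0 < β j) {x : EuclideanSpace ℝ (Fin n)}
    (hx : x ∈ P.carrier) : EuclideanSpace ℝ (Fin n) ≃L[ℝ] EuclideanSpace ℝ (Fin n) :=
  (LinearEquiv.ofInjectiveEndo (P.hessSymplectic β x).toLinearMap
    (P.injective_hessSymplectic hβ hx)).toContinuousLinearEquiv

theorem coe_hessEquiv (hβ : ∀ j, 0 < β j) {x : EuclideanSpace ℝ (Fin n)} (hx : x ∈ P.carrier) :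
    (P.hessEquiv hβ hx : EuclideanSpace ℝ (Fin n) →L[ℝ] EuclideanSpace ℝ (Fin n)) =
      P.hessSymplectic β x := by
  ext w : 1
  rfl

/-- The inverse Hessian is positive semidefinite. -/
theorem isPositive_hessEquiv_symm (hβ : ∀ j, 0 < β j) {x : EuclideanSpace ℝ (Fin n)}
    (hx : x ∈ P.carrier) :
    ((P.hessEquiv hβ hx).symm :
      EuclideanSpace ℝ (Fin n) →L[ℝ] EuclideanSpace ℝ (Fin n)).toLinearMap.IsPositive := by
  have hH : ∀ w, P.hessSymplectic β x ((P.hessEquiv hβ hx).symm w) = w := fun w => by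
    rw [← P.coe_hessEquiv hβ hx]; simp
  have hsymm : ∀ w z, ⟪P.hessSymplectic β x w, z⟫ = ⟪w, P.hessSymplectic β x z⟫ := fun w z => by
    rw [real_inner_comm _ w, P.inner_hessSymplectic, P.inner_hessSymplectic]
    refine Finset.sum_congr rfl fun j _ => by ring
  refine ⟨fun w z => ?_, fun w => ?_⟩
  · have h := hsymm ((P.hessEquiv hβ hx).symm w) ((P.hessEquiv hβ hx).symm z)
    rw [hH, hH] at h
    exact h.symm
  · have h := P.inner_hessSymplectic (β := β) x ((P.hessEquiv hβ hx).symm w)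
      ((P.hessEquiv hβ hx).symm w)
    rw [hH] at h
    change 0 ≤ ⟪(P.hessEquiv hβ hx).symm w, w⟫
    rw [real_inner_comm, h]
    refine Finset.sum_nonneg fun j _ => ?_
    rw [mul_assoc]
    exact mul_nonneg (inv_nonneg.mpr (mul_pos (hβ j) (hx j)).le) (mul_self_nonneg _)

theorem continuous_refSymplectic : Continuous (P.refSymplectic β) := by
  unfold refSymplectic
  refine continuous_finsetSum _ fun j _ => ?_
  exact (Real.continuous_mul_log.comp (P.continuous_l j)).div_const _

/-- A maximizer over the closed polytope is interior because `t ↦ t * log t` has slope `-∞` at `0`,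
so the gradient of the reference symplectic potential takes every value. -/
theorem exists_gradSymplectic_eq (hβ : ∀ j, 0 < β j) (ρ : EuclideanSpace ℝ (Fin n)) :
    ∃ x ∈ P.carrier, P.gradSymplectic β x = ρ := by
  have hK : IsCompact (closure P.carrier) := P.isBounded_carrier.isCompact_closure
  set h : EuclideanSpace ℝ (Fin n) → ℝ := fun x => ⟪ρ, x⟫ - P.refSymplectic β x with hh
  have hcont : Continuous h := (continuous_const.inner continuous_id).sub P.continuous_refSymplectic
  obtain ⟨x, hxK, hmax⟩ := hK.exists_isMaxOn P.carrier_nonempty.closure hcont.continuousOn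
  have hxnn : ∀ j, 0 ≤ P.l j x := fun j => by
    have : closure P.carrier ⊆ {x | 0 ≤ P.l j x} :=
      closure_minimal (fun y hy => (hy j).le) (isClosed_le continuous_const (P.continuous_l j))
    exact this hxK
  have hxP : x ∈ P.carrier := by
    intro j
    by_contra hj
    have hj0 : P.l j x = 0 := le_antisymm (not_lt.mp hj) (hxnn j)
    obtain ⟨z, hz⟩ := P.carrier_nonempty
    set F : ℝ → ℝ := fun t => t * Real.log t with hF
    set D : ℝ := ⟪ρ, z - x⟫ - ∑ k, (F (P.l k z) - F (P.l k x)) / β k with hD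
    have hineq : ∀ t : ℝ, 0 < t → t < 1 → D - P.l j z * Real.log t / β j ≤ 0 := by
      intro t ht0 ht1
      have hmem : x + t • (z - x) ∈ P.carrier := fun k => by
        rw [P.l_lineMap]
        have := mul_pos ht0 (hz k)
        have := mul_nonneg (by linarith : (0 : ℝ) ≤ 1 - t) (hxnn k)
        linarith
      have h1 : h (x + t • (z - x)) ≤ h x := hmax (subset_closure hmem)
      have hterm : ∀ k, F (P.l k (x + t • (z - x))) / β k ≤ F (P.l k x) / β k
          + t * ((F (P.l k z) - F (P.l k x)) / β k)
          + (if k = j then t * (P.l j z * Real.log t / β j) else 0) := by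
        intro k
        rw [P.l_lineMap]
        split_ifs with hkj
        · subst hkj
          rw [hj0]
          have e : F ((1 - t) * 0 + t * P.l k z) =
              t * F (P.l k z) + t * (P.l k z * Real.log t) := by
            simp only [hF, mul_zero, zero_add]
            rw [Real.log_mul ht0.ne' (hz k).ne']; ring
          have e0 : F 0 = 0 := by simp [hF]
          rw [e, e0]
          apply le_of_eq; ring
        · have hc := Real.convexOn_mul_log.2 (hxnn k : P.l k x ∈ Set.Ici 0)
            ((hz k).le : P.l k z ∈ Set.Ici 0) (by linarith : (0 : ℝ) ≤ 1 - t) ht0.le (by ring)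
          simp only [smul_eq_mul] at hc
          have h2 := div_le_div_of_nonneg_right hc (hβ k).le
          calc F ((1 - t) * P.l k x + t * P.l k z) / β k ≤ _ := h2
            _ = _ := by simp only [hF]; ring
      have hsum := Finset.sum_le_sum fun k (_ : k ∈ Finset.univ) => hterm k
      rw [Finset.sum_add_distrib, Finset.sum_add_distrib, ← Finset.mul_sum,
        Finset.sum_ite_eq' Finset.univ j, if_pos (Finset.mem_univ j)] at hsum
      have h3 : h (x + t • (z - x)) - h x = t * ⟪ρ, z - x⟫
          - (∑ k, F (P.l k (x + t • (z - x))) / β k - ∑ k, F (P.l k x) / β k) := by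
        simp only [hh, refSymplectic, hF, inner_add_right, inner_smul_right]; ring
      have h4 : t * (D - P.l j z * Real.log t / β j) ≤ t * 0 := by
        rw [hD]; linarith
      exact le_of_mul_le_mul_left h4 ht0
    have hlim : Filter.Tendsto (fun t => D - P.l j z * Real.log t / β j)
        (nhdsWithin 0 (Set.Ioi 0)) Filter.atTop := by
      have h1 : Filter.Tendsto (fun t => Real.log t * (P.l j z / β j))
          (nhdsWithin 0 (Set.Ioi 0)) Filter.atBot :=
        Real.tendsto_log_nhdsGT_zero.atBot_mul_const (div_pos (hz j) (hβ j))
      have h2 := Filter.tendsto_atTop_add_const_left _ D (Filter.tendsto_neg_atBot_atTop.comp h1)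
      refine h2.congr fun t => ?_
      simp only [Function.comp]; ring
    have hev := hlim.eventually (Filter.eventually_gt_atTop 0)
    have hev1 : ∀ᶠ t : ℝ in nhdsWithin 0 (Set.Ioi 0), t ∈ Set.Ioo (0 : ℝ) 1 :=
      Ioo_mem_nhdsGT one_pos
    obtain ⟨t, ht, ht0, ht1⟩ := (hev.and hev1).exists
    linarith [hineq t ht0 ht1]
  refine ⟨x, hxP, ?_⟩
  have hloc : IsLocalMax h x :=
    (hmax.isLocalMax (Filter.mem_of_superset (P.isOpen_carrier.mem_nhds hxP) subset_closure))
  have hder : HasFDerivAt h (innerSL ℝ ρ - innerSL ℝ (P.gradSymplectic β x)) x :=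
    (innerSL ℝ ρ).hasFDerivAt.sub (P.hasFDerivAt_refSymplectic β hxP)
  have h0 := hloc.hasFDerivAt_eq_zero hder
  rw [sub_eq_zero] at h0
  exact ((innerSL_inj).mp h0).symm

variable (β)

/-- The inverse of the gradient of the reference symplectic potential. It is the gradient of the
reference potential. -/
noncomputable def refMoment (ρ : EuclideanSpace ℝ (Fin n)) : EuclideanSpace ℝ (Fin n) :=
  Function.invFunOn (P.gradSymplectic β) P.carrier ρ

variable {β}

theorem refMoment_mem (hβ : ∀ j, 0 < β j) (ρ : EuclideanSpace ℝ (Fin n)) :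
    P.refMoment β ρ ∈ P.carrier :=
  Function.invFunOn_mem (P.exists_gradSymplectic_eq hβ ρ)

theorem gradSymplectic_refMoment (hβ : ∀ j, 0 < β j) (ρ : EuclideanSpace ℝ (Fin n)) :
    P.gradSymplectic β (P.refMoment β ρ) = ρ :=
  Function.invFunOn_eq (P.exists_gradSymplectic_eq hβ ρ)

theorem isGreatest_refPotential (hβ : ∀ j, 0 < β j) (ρ : EuclideanSpace ℝ (Fin n)) :
    IsGreatest (Set.range fun x : P.carrier => ⟪(x : EuclideanSpace ℝ (Fin n)), ρ⟫
      - P.refSymplectic β x) (⟪P.refMoment β ρ, ρ⟫ - P.refSymplectic β (P.refMoment β ρ)) := by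
  refine ⟨⟨⟨_, P.refMoment_mem hβ ρ⟩, rfl⟩, ?_⟩
  rintro _ ⟨⟨y, hy⟩, rfl⟩
  have h := P.refSymplectic_add_inner_le hβ (P.refMoment_mem hβ ρ) hy
  rw [P.gradSymplectic_refMoment hβ, inner_sub_right, real_inner_comm y, real_inner_comm _ ρ] at h
  linarith

theorem refPotential_eq (hβ : ∀ j, 0 < β j) (ρ : EuclideanSpace ℝ (Fin n)) :
    P.refPotential β ρ = ⟪P.refMoment β ρ, ρ⟫ - P.refSymplectic β (P.refMoment β ρ) :=
  (P.isGreatest_refPotential hβ ρ).csSup_eq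

theorem inner_sub_refSymplectic_le_refPotential (hβ : ∀ j, 0 < β j)
    {x : EuclideanSpace ℝ (Fin n)} (hx : x ∈ P.carrier) (ρ : EuclideanSpace ℝ (Fin n)) :
    ⟪x, ρ⟫ - P.refSymplectic β x ≤ P.refPotential β ρ := by
  rw [P.refPotential_eq hβ]
  exact (P.isGreatest_refPotential hβ ρ).2 ⟨⟨x, hx⟩, rfl⟩

theorem refPotential_add_inner_le (hβ : ∀ j, 0 < β j) (ρ ρ' : EuclideanSpace ℝ (Fin n)) :
    P.refPotential β ρ + ⟪P.refMoment β ρ, ρ' - ρ⟫ ≤ P.refPotential β ρ' := by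
  have h := P.inner_sub_refSymplectic_le_refPotential hβ (P.refMoment_mem hβ ρ) ρ'
  rw [P.refPotential_eq hβ ρ, inner_sub_right]
  linarith

theorem hasFDerivAt_refMoment (hβ : ∀ j, 0 < β j) (ρ : EuclideanSpace ℝ (Fin n)) :
    HasFDerivAt (P.refMoment β) ((P.hessEquiv hβ (P.refMoment_mem hβ ρ)).symm :
      EuclideanSpace ℝ (Fin n) →L[ℝ] EuclideanSpace ℝ (Fin n)) ρ := by
  have hx := P.refMoment_mem hβ ρ
  have hG := P.gradSymplectic_refMoment hβ ρ
  have hs : HasStrictFDerivAt (P.gradSymplectic β)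
      (P.hessEquiv hβ hx : EuclideanSpace ℝ (Fin n) →L[ℝ] EuclideanSpace ℝ (Fin n))
      (P.refMoment β ρ) := by
    rw [P.coe_hessEquiv]; exact P.hasStrictFDerivAt_gradSymplectic β hx
  have h1 := hs.to_localInverse.hasFDerivAt
  have h2 := hs.eventually_right_inverse
  have h3 := hs.localInverse_tendsto.eventually (P.isOpen_carrier.mem_nhds hx)
  rw [hG] at h1 h2 h3
  refine h1.congr_of_eventuallyEq ?_
  filter_upwards [h2, h3] with y hy1 hy2
  refine P.injOn_gradSymplectic hβ (P.refMoment_mem hβ y) hy2 ?_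
  rw [hy1, P.gradSymplectic_refMoment hβ]

theorem hasGradientAt_refPotential (hβ : ∀ j, 0 < β j) (ρ : EuclideanSpace ℝ (Fin n)) :
    HasGradientAt (P.refPotential β) (P.refMoment β ρ) ρ :=
  hasGradientAt_of_subgradient (P.refPotential_add_inner_le hβ)
    (P.hasFDerivAt_refMoment hβ ρ).continuousAt

theorem gradient_refPotential (hβ : ∀ j, 0 < β j) :
    gradient (P.refPotential β) = P.refMoment β :=
  funext fun ρ => (P.hasGradientAt_refPotential hβ ρ).gradient

theorem hasGradientAt_log_l_refMoment (hβ : ∀ j, 0 < β j) (j : Fin N)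
    (ρ : EuclideanSpace ℝ (Fin n)) :
    HasGradientAt (fun ρ' => Real.log (P.l j (P.refMoment β ρ')))
      ((P.hessEquiv hβ (P.refMoment_mem hβ ρ)).symm
        ((P.l j (P.refMoment β ρ))⁻¹ • P.normal j)) ρ := by
  have hx := P.refMoment_mem hβ ρ
  have h1 := (((P.hasStrictFDerivAt_l j (P.refMoment β ρ)).hasFDerivAt).log (hx j).ne').comp ρ
    (P.hasFDerivAt_refMoment hβ ρ)
  rw [hasGradientAt_iff_hasFDerivAt]
  refine h1.congr_fderiv ?_
  ext w
  have h2 := (P.isPositive_hessEquiv_symm hβ hx).1 ((P.l j (P.refMoment β ρ))⁻¹ • P.normal j) w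
  simp only [ContinuousLinearMap.coe_coe, ContinuousLinearEquiv.coe_coe] at h2
  rw [InnerProductSpace.toDual_apply_apply, h2]
  simp [inner_smul_left]

/-- The gradient of `log (l j)` along the reference moment map solves a weighted least squares
problem, whose weights depend on the point but whose solutions are bounded uniformly. -/
theorem exists_isGradientBound (hβ : ∀ j, 0 < β j) : ∃ Λ : ℝ, P.IsGradientBound β Λ := by
  have key := fun j => exists_norm_le_of_normal_equation P.normal
    (fun k => if k = j then β j else 0) (fun w hw => P.eq_zero_of_forall_inner_normal_eq_zero hw)
  choose Λ hΛ using key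
  refine ⟨∑ j, |Λ j|, fun j ρ => ?_⟩
  refine le_trans ?_ ((le_abs_self (Λ j)).trans
    (Finset.single_le_sum (fun j _ => abs_nonneg (Λ j)) (Finset.mem_univ j)))
  rw [P.gradient_refPotential hβ, (P.hasGradientAt_log_l_refMoment hβ j ρ).gradient]
  have hx := P.refMoment_mem hβ ρ
  set x := P.refMoment β ρ
  refine hΛ j (fun k => (β k * P.l k x)⁻¹) _ (fun k => inv_pos.mpr (mul_pos (hβ k) (hx k))) ?_
  set w := (P.hessEquiv hβ hx).symm ((P.l j x)⁻¹ • P.normal j) with hw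
  have h1 : P.hessSymplectic β x w = (P.l j x)⁻¹ • P.normal j := by
    rw [← P.coe_hessEquiv hβ hx, hw]; simp
  rw [P.hessSymplectic_apply] at h1
  simp only [mul_sub, sub_smul, Finset.sum_sub_distrib]
  rw [h1, sub_eq_zero, Finset.sum_eq_single j]
  · rw [if_pos rfl]
    congr 1
    have := (hβ j).ne'
    have := (hx j).ne'
    field_simp
  · intro k _ hk
    simp [hk]
  · simp

theorem differentiable_log_l_refMoment (hβ : ∀ j, 0 < β j) (j : Fin N) :
    Differentiable ℝ fun ρ => Real.log (P.l j (P.refMoment β ρ)) := fun ρ =>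
  (P.hasGradientAt_log_l_refMoment hβ j ρ).hasFDerivAt.differentiableAt

/-- A gradient bound is a Harnack inequality for the functions `l j` along the reference moment
map. -/
theorem IsGradientBound.l_refMoment_le {P : DelzantPolytope n N} {Λ : ℝ}
    (hΛ : P.IsGradientBound β Λ) (hβ : ∀ j, 0 < β j) (j : Fin N)
    (ρ ρ' : EuclideanSpace ℝ (Fin n)) :
    P.l j (P.refMoment β ρ') ≤ P.l j (P.refMoment β ρ) * Real.exp (Λ * ‖ρ' - ρ‖) := by
  have h := Convex.norm_image_sub_le_of_norm_fderiv_le (𝕜 := ℝ) (s := Set.univ) (x := ρ) (y := ρ')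
    (f := fun ρ => Real.log (P.l j (P.refMoment β ρ))) (C := Λ)
    (fun y _ => P.differentiable_log_l_refMoment hβ j y) (fun y _ => ?_) convex_univ
    (Set.mem_univ _) (Set.mem_univ _)
  · have h1 := P.refMoment_mem hβ ρ j
    have h2 := P.refMoment_mem hβ ρ' j
    have h3 := (le_abs_self _).trans h
    rw [← Real.log_le_log_iff h2 (by positivity), Real.log_mul h1.ne' (Real.exp_pos _).ne',
      Real.log_exp]
    linarith
  · have h1 := hΛ j y
    rw [P.gradient_refPotential hβ] at h1
    rwa [gradient, LinearIsometryEquiv.norm_map] at h1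

end DelzantPolytope

/-! ### Log-concave densities with a Monge-Ampère lower bound -/

section LogConcave

variable {E : Type*} [NormedAddCommGroup E] [InnerProductSpace ℝ E] [FiniteDimensional ℝ E]

/-- `W` is a coercive convex function with gradient `g` and Hessian `A`, such that `g` is injective
and bounded by `M`, and such that the Monge-Ampère measure of `W` is at least `c₀ * exp (-W)`. -/
structure IsTamePotential (W : E → ℝ) (g : E → E) (A : E → E →L[ℝ] E) (M c₀ : ℝ) : Prop where
  hasGradientAt : ∀ ρ, HasGradientAt W (g ρ) ρ
  hasFDerivAt : ∀ ρ, HasFDerivAt g (A ρ) ρ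
  subgradient : ∀ ρ ρ', W ρ + ⟪g ρ, ρ' - ρ⟫ ≤ W ρ'
  injective : Function.Injective g
  norm_le : ∀ ρ, ‖g ρ‖ ≤ M
  density : ∀ ρ, c₀ * Real.exp (-W ρ) ≤ |(A ρ).det|
  coercive : ∃ a > 0, ∃ b, ∀ ρ, a * ‖ρ‖ - b ≤ W ρ

namespace IsTamePotential

variable {W : E → ℝ} {g : E → E} {A : E → E →L[ℝ] E} {M c₀ : ℝ}

theorem continuous (h : IsTamePotential W g A M c₀) : Continuous W :=
  continuous_iff_continuousAt.mpr fun ρ => (h.hasGradientAt ρ).hasFDerivAt.continuousAt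

theorem continuous_gradient (h : IsTamePotential W g A M c₀) : Continuous g :=
  continuous_iff_continuousAt.mpr fun ρ => (h.hasFDerivAt ρ).continuousAt

theorem hasFDerivAt_exp (h : IsTamePotential W g A M c₀) (ρ : E) :
    HasFDerivAt (fun ρ => Real.exp (-W ρ)) (-(Real.exp (-W ρ) • innerSL ℝ (g ρ))) ρ := by
  have h1 := (h.hasGradientAt ρ).hasFDerivAt.neg.exp
  refine h1.congr_fderiv ?_
  ext v
  simp

theorem abs_inner_gradient_le (h : IsTamePotential W g A M c₀) (v ρ : E) :
    |⟪g ρ, v⟫| ≤ M * ‖v‖ :=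
  (abs_real_inner_le_norm _ _).trans (by gcongr; exact h.norm_le ρ)

theorem le_min_add (h : IsTamePotential W g A M c₀) (ρ₀ ρ : E) :
    W ρ ≤ W ρ₀ + M * ‖ρ - ρ₀‖ := by
  have h1 := h.subgradient ρ ρ₀
  rw [← neg_sub ρ ρ₀, inner_neg_right] at h1
  have h2 := (le_abs_self _).trans (h.abs_inner_gradient_le (ρ - ρ₀) ρ)
  linarith

theorem exists_isMin (h : IsTamePotential W g A M c₀) : ∃ ρ₀, ∀ ρ, W ρ₀ ≤ W ρ := by
  obtain ⟨a, ha, b, hW⟩ := h.coercive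
  refine h.continuous.exists_forall_le ?_
  refine Filter.tendsto_atTop_mono hW ?_
  exact Filter.tendsto_atTop_add_const_right _ _ ((tendsto_norm_cocompact_atTop).const_mul_atTop ha)

variable [MeasurableSpace E] [BorelSpace E]

theorem integrable_mul_exp (h : IsTamePotential W g A M c₀) {f : E → ℝ} (hf : Continuous f)
    {K : ℝ} (hK : ∀ ρ, |f ρ| ≤ K * (1 + ‖ρ‖)) :
    Integrable fun ρ => f ρ * Real.exp (-W ρ) := by
  obtain ⟨a, ha, b, hW⟩ := h.coercive
  have hcont := h.continuous
  have hK0 : 0 ≤ K := by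
    have := hK 0
    simp only [norm_zero, add_zero, mul_one] at this
    exact (abs_nonneg _).trans this
  have h1 := (integrable_exp_neg_mul_norm (E := E) (half_pos ha)).const_mul
    (K * (1 + 2 / a) * Real.exp b)
  refine h1.mono' (by fun_prop) (Filter.Eventually.of_forall fun ρ => ?_)
  rw [Real.norm_eq_abs, abs_mul, abs_of_pos (Real.exp_pos _)]
  have h2 : 1 + ‖ρ‖ ≤ (1 + 2 / a) * Real.exp (a / 2 * ‖ρ‖) := by
    have h3 := Real.add_one_le_exp (a / 2 * ‖ρ‖)
    have h4 : 0 ≤ a / 2 * ‖ρ‖ := by positivity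
    have h5 : 2 / a * (a / 2 * ‖ρ‖) ≤ 2 / a * Real.exp (a / 2 * ‖ρ‖) := by
      gcongr; linarith
    have h6 : 2 / a * (a / 2 * ‖ρ‖) = ‖ρ‖ := by field_simp
    nlinarith
  have h3 : Real.exp (-W ρ) ≤ Real.exp b * (Real.exp (-(a / 2 * ‖ρ‖)) *
      Real.exp (-(a / 2 * ‖ρ‖))) := by
    rw [← Real.exp_add, ← Real.exp_add, Real.exp_le_exp]
    linarith [hW ρ]
  have h4 : Real.exp (a / 2 * ‖ρ‖) * Real.exp (-(a / 2 * ‖ρ‖)) = 1 := by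
    rw [← Real.exp_add]; simp
  calc |f ρ| * Real.exp (-W ρ)
      ≤ (K * ((1 + 2 / a) * Real.exp (a / 2 * ‖ρ‖))) * (Real.exp b *
        (Real.exp (-(a / 2 * ‖ρ‖)) * Real.exp (-(a / 2 * ‖ρ‖)))) := by
        gcongr
        exact (hK ρ).trans (by gcongr)
    _ = K * (1 + 2 / a) * Real.exp b * (Real.exp (a / 2 * ‖ρ‖) * Real.exp (-(a / 2 * ‖ρ‖))) *
        Real.exp (-(a / 2 * ‖ρ‖)) := by ring
    _ = _ := by rw [h4, mul_one]

theorem integrable_mul_exp_of_abs_le (h : IsTamePotential W g A M c₀) {f : E → ℝ}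
    (hf : Continuous f) {K : ℝ} (hK : ∀ ρ, |f ρ| ≤ K) :
    Integrable fun ρ => f ρ * Real.exp (-W ρ) := by
  refine h.integrable_mul_exp hf (K := K) fun ρ => (hK ρ).trans ?_
  have h1 : 0 ≤ K := (abs_nonneg _).trans (hK 0)
  nlinarith [norm_nonneg ρ]

theorem integrable_exp (h : IsTamePotential W g A M c₀) :
    Integrable fun ρ => Real.exp (-W ρ) := by
  simpa using h.integrable_mul_exp_of_abs_le (f := fun _ => 1) continuous_const (K := 1) (by simp)

/-- Integration by parts against the density `exp (-W)`. -/
theorem integral_inner_gradient_mul (h : IsTamePotential W g A M c₀) {f : E → ℝ} {v : E} {D K : ℝ}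
    (hf : Continuous f) (hK : ∀ ρ, |f ρ| ≤ K * (1 + ‖ρ‖))
    (hD : ∀ ρ, HasFDerivAt f (D • innerSL ℝ v) ρ) :
    ∫ ρ, f ρ * ⟪g ρ, v⟫ * Real.exp (-W ρ) = D * ‖v‖ ^ 2 * ∫ ρ, Real.exp (-W ρ) := by
  have hg := h.continuous_gradient
  have hfd : ∀ ρ, fderiv ℝ f ρ v = D * ‖v‖ ^ 2 := fun ρ => by
    rw [(hD ρ).fderiv]; simp
  have hed : ∀ ρ, fderiv ℝ (fun ρ => Real.exp (-W ρ)) ρ v = -(⟪g ρ, v⟫ * Real.exp (-W ρ)) :=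
    fun ρ => by rw [(h.hasFDerivAt_exp ρ).fderiv]; simp [mul_comm]
  have key := integral_mul_fderiv_eq_neg_fderiv_mul_of_integrable (μ := (volume : Measure E))
    (f := f) (g := fun ρ => Real.exp (-W ρ)) (v := v) ?_ ?_ ?_
    (fun ρ _ => (hD ρ).differentiableAt) (fun ρ _ => (h.hasFDerivAt_exp ρ).differentiableAt)
  · simp only [hfd, hed, integral_const_mul, mul_neg, integral_neg, neg_inj] at key
    rw [← key]
    simp only [mul_assoc]
  · simp only [hfd]
    exact h.integrable_exp.const_mul _
  · simp only [hed, mul_neg, ← mul_assoc]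
    refine Integrable.neg (h.integrable_mul_exp (f := fun ρ => f ρ * ⟪g ρ, v⟫) (by fun_prop)
      (K := K * (M * ‖v‖)) fun ρ => ?_)
    rw [abs_mul]
    have h1 := h.abs_inner_gradient_le v ρ
    calc |f ρ| * |⟪g ρ, v⟫| ≤ (K * (1 + ‖ρ‖)) * (M * ‖v‖) :=
          mul_le_mul (hK ρ) h1 (abs_nonneg _) ((abs_nonneg _).trans (hK ρ))
      _ = _ := by ring
  · exact h.integrable_mul_exp hf hK

theorem integral_inner_gradient (h : IsTamePotential W g A M c₀) (v : E) :
    ∫ ρ, ⟪g ρ, v⟫ * Real.exp (-W ρ) = 0 := by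
  have := h.integral_inner_gradient_mul (f := fun _ => 1) (v := v) (D := 0) (K := 1)
    continuous_const (fun ρ => by simp) (fun ρ => by simpa using hasFDerivAt_const (1 : ℝ) ρ)
  simpa using this

theorem integrable_inner_gradient_sub (h : IsTamePotential W g A M c₀) (ρ₀ : E) :
    Integrable fun ρ => ⟪g ρ, ρ - ρ₀⟫ * Real.exp (-W ρ) := by
  have hg := h.continuous_gradient
  refine h.integrable_mul_exp (f := fun ρ => ⟪g ρ, ρ - ρ₀⟫) (by fun_prop)
    (K := M * (1 + ‖ρ₀‖)) fun ρ => ?_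
  refine (abs_inner_sub_le _ _ _).trans ?_
  gcongr
  exact h.norm_le ρ

theorem integral_inner_gradient_sub (h : IsTamePotential W g A M c₀) (ρ₀ : E) :
    ∫ ρ, ⟪g ρ, ρ - ρ₀⟫ * Real.exp (-W ρ) = Module.finrank ℝ E * ∫ ρ, Real.exp (-W ρ) := by
  have hg := h.continuous_gradient
  set b := stdOrthonormalBasis ℝ E
  have h1 : ∀ i, ∫ ρ, ⟪b i, ρ - ρ₀⟫ * ⟪g ρ, b i⟫ * Real.exp (-W ρ) = ∫ ρ, Real.exp (-W ρ) := by
    intro i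
    have h2 := h.integral_inner_gradient_mul (f := fun ρ => ⟪b i, ρ - ρ₀⟫) (v := b i) (D := 1)
      (K := ‖b i‖ * (1 + ‖ρ₀‖)) (by fun_prop) (abs_inner_sub_le _ _) (fun ρ => ?_)
    · rw [h2, b.orthonormal.1 i]; ring
    · have h3 := (innerSL ℝ (b i)).hasFDerivAt.comp ρ ((hasFDerivAt_id ρ).sub_const ρ₀)
      refine h3.congr_fderiv ?_
      ext w; simp
  have h4 : ∀ ρ, ⟪g ρ, ρ - ρ₀⟫ * Real.exp (-W ρ) =
      ∑ i, ⟪b i, ρ - ρ₀⟫ * ⟪g ρ, b i⟫ * Real.exp (-W ρ) := fun ρ => by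
    rw [← Finset.sum_mul, ← b.sum_inner_mul_inner]
    simp only [mul_comm]
  simp only [h4]
  rw [integral_finsetSum]
  · simp [h1]
  · intro i _
    refine h.integrable_mul_exp (f := fun ρ => ⟪b i, ρ - ρ₀⟫ * ⟪g ρ, b i⟫) (by fun_prop)
      (K := ‖b i‖ * (1 + ‖ρ₀‖) * (M * ‖b i‖)) fun ρ => ?_
    rw [abs_mul]
    calc _ ≤ (‖b i‖ * (1 + ‖ρ₀‖) * (1 + ‖ρ‖)) * (M * ‖b i‖) :=
          mul_le_mul (abs_inner_sub_le _ _ _) (h.abs_inner_gradient_le _ _) (abs_nonneg _)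
            (by positivity)
      _ = _ := by ring

/-- The gradient map pushes `exp (-W)` forward to a measure with density at most `c₀⁻¹`, which
therefore gives little mass to thin slabs. -/
theorem setIntegral_slab_le (h : IsTamePotential W g A M c₀) (hM : 0 < M) (hc : 0 < c₀)
    {κ : ℝ} (hκ : 0 < κ) {θ : E} (hθ : ‖θ‖ = 1) :
    c₀ * ∫ ρ in {ρ | |⟪θ, g ρ⟫| ≤ κ}, Real.exp (-W ρ) ≤
      κ / M * (volume (Metric.closedBall (0 : E) (2 * M))).toReal := by
  have hg := h.continuous_gradient
  have hW := h.continuous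
  set D := {ρ | |⟪θ, g ρ⟫| ≤ κ} with hD
  have hmeas : MeasurableSet D := measurableSet_le (by fun_prop) (by fun_prop)
  have h1 : ∫⁻ ρ in D, ENNReal.ofReal (c₀ * Real.exp (-W ρ)) ≤
      ENNReal.ofReal (κ / M) * volume (Metric.closedBall (0 : E) (2 * M)) := by
    calc _ ≤ ∫⁻ ρ in D, ENNReal.ofReal |(A ρ).det| :=
          lintegral_mono fun ρ => ENNReal.ofReal_le_ofReal (h.density ρ)
      _ = volume (g '' D) := lintegral_abs_det_fderiv_eq_addHaar_image volume hmeas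
          (fun ρ _ => (h.hasFDerivAt ρ).hasFDerivWithinAt) h.injective.injOn
      _ ≤ _ := by
        refine volume_le_of_subset_slab (a := 0) hM hκ hθ ?_
        rintro _ ⟨ρ, hρ, rfl⟩
        exact ⟨h.norm_le ρ, by rw [sub_zero]; exact hρ⟩
  rw [← integral_const_mul, integral_eq_lintegral_of_nonneg_ae
    (Filter.Eventually.of_forall fun ρ => by positivity) (by fun_prop)]
  have hfin : volume (Metric.closedBall (0 : E) (2 * M)) ≠ ⊤ := measure_closedBall_lt_top.ne
  calc _ ≤ (ENNReal.ofReal (κ / M) * volume (Metric.closedBall (0 : E) (2 * M))).toReal :=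
        ENNReal.toReal_mono (ENNReal.mul_ne_top ENNReal.ofReal_ne_top hfin) h1
    _ = _ := by rw [ENNReal.toReal_mul, ENNReal.toReal_ofReal (by positivity)]

/-- Linear growth with explicit constants. The function `⟪g ρ, ρ - ρ₀⟫` has mean `dim E`, so it is
bounded by `T` off a set of small mass, and each point where it is at most `T` gives an affine lower
bound for `W`. If none of these had slope `κ / 8` in the direction `θ`, then, `⟪θ, g⟫` having mean
zero, it would be small in mean, which contradicts the estimate for slabs. -/
theorem linear_growth (h : IsTamePotential W g A M c₀) (hM : 0 < M) (hc : 0 < c₀)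
    {κ : ℝ} (hκ : 0 < κ) (hκV : κ / M * (volume (Metric.closedBall (0 : E) (2 * M))).toReal ≤
      c₀ * ((∫ ρ, Real.exp (-W ρ)) / 4))
    {ρ₀ : E} (hmin : ∀ ρ, W ρ₀ ≤ W ρ) (ρ' : E) :
    W ρ₀ + κ / 8 * ‖ρ' - ρ₀‖ - 8 * M * (Module.finrank ℝ E + 1) / κ ≤ W ρ' := by
  have hg := h.continuous_gradient
  have hW := h.continuous
  set d : ℝ := (Module.finrank ℝ E : ℝ) with hd
  have hd0 : 0 ≤ d := Nat.cast_nonneg _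
  set T : ℝ := 8 * M * (d + 1) / κ with hT
  have hT0 : 0 < T := by positivity
  rcases eq_or_ne ρ' ρ₀ with rfl | hne
  · simp only [sub_self, norm_zero, mul_zero]; linarith
  have hn : 0 < ‖ρ' - ρ₀‖ := norm_pos_iff.mpr (sub_ne_zero.mpr hne)
  set θ : E := ‖ρ' - ρ₀‖⁻¹ • (ρ' - ρ₀) with hθdef
  have hθ : ‖θ‖ = 1 := by rw [hθdef, norm_smul, norm_inv, norm_norm, inv_mul_cancel₀ hn.ne']
  have hρθ : ρ' - ρ₀ = ‖ρ' - ρ₀‖ • θ := by rw [hθdef, smul_smul, mul_inv_cancel₀ hn.ne', one_smul]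
  set G : E → ℝ := fun ρ => ⟪g ρ, ρ - ρ₀⟫ with hG
  set p : E → ℝ := fun ρ => ⟪θ, g ρ⟫ with hp
  have hG0 : ∀ ρ, W ρ - W ρ₀ ≤ G ρ := fun ρ => by
    have h1 := h.subgradient ρ ρ₀
    rw [← neg_sub ρ ρ₀, inner_neg_right] at h1
    simp only [hG]; linarith
  have hGnn : ∀ ρ, 0 ≤ G ρ := fun ρ => by linarith [hG0 ρ, hmin ρ]
  by_contra! hlt
  have hsmall : ∀ ρ, G ρ ≤ T → p ρ < κ / 8 := by
    intro ρ hρ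
    by_contra! hge
    have h1 := h.subgradient ρ ρ'
    have h2 : ⟪g ρ, ρ' - ρ⟫ = ‖ρ' - ρ₀‖ * p ρ - G ρ := by
      have : ρ' - ρ = (ρ' - ρ₀) - (ρ - ρ₀) := by abel
      rw [this, inner_sub_right, hρθ, inner_smul_right, real_inner_comm]
      simp only [hp, hG, ← hρθ]
    have h3 : ‖ρ' - ρ₀‖ * (κ / 8) ≤ ‖ρ' - ρ₀‖ * p ρ := by gcongr
    linarith [hmin ρ]
  have hpM : ∀ ρ, |p ρ| ≤ M := fun ρ =>
    (abs_real_inner_le_norm _ _).trans (by rw [hθ, one_mul]; exact h.norm_le ρ)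
  -- Uses `|p| = 2 p⁺ - p`, where `p⁺ ≤ κ / 8` on `{G ≤ T}` and `p⁺ ≤ M ≤ M G / T` elsewhere.
  have hpt : ∀ ρ, |p ρ| ≤ κ / 4 + 2 * M / T * G ρ - p ρ := by
    intro ρ
    have hnn : 0 ≤ 2 * M / T * G ρ := mul_nonneg (by positivity) (hGnn ρ)
    rcases le_or_gt (p ρ) 0 with h0 | h0
    · rw [abs_of_nonpos h0]; linarith
    rw [abs_of_pos h0]
    rcases le_or_gt (G ρ) T with h1 | h1
    · linarith [hsmall ρ h1]
    · have h2 : 2 * M ≤ 2 * M / T * G ρ := by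
        rw [div_mul_eq_mul_div, le_div_iff₀ hT0]; gcongr
      have h3 := (le_abs_self _).trans (hpM ρ)
      linarith
  set V := ∫ ρ, Real.exp (-W ρ) with hV
  have hV0 : 0 < V := integral_exp_pos h.integrable_exp
  have hcp : Continuous p := by fun_prop
  have hi1 := h.integrable_exp.const_mul (κ / 4)
  have hi2 := (h.integrable_inner_gradient_sub ρ₀).const_mul (2 * M / T)
  have hi3 := h.integrable_mul_exp_of_abs_le hcp hpM
  have hi4 : Integrable fun ρ => |p ρ| * Real.exp (-W ρ) :=
    h.integrable_mul_exp_of_abs_le hcp.abs (K := M) (fun ρ => by rw [abs_abs]; exact hpM ρ)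
  have hi12 : Integrable fun ρ => κ / 4 * Real.exp (-W ρ) + 2 * M / T * (G ρ * Real.exp (-W ρ)) :=
    hi1.add hi2
  have hp0 : ∫ ρ, p ρ * Real.exp (-W ρ) = 0 := by
    simp only [hp, real_inner_comm]
    exact h.integral_inner_gradient θ
  have hupper : ∫ ρ, |p ρ| * Real.exp (-W ρ) ≤ κ / 4 * V + 2 * M / T * (d * V) := by
    calc _ ≤ ∫ ρ, (κ / 4 * Real.exp (-W ρ) + 2 * M / T * (G ρ * Real.exp (-W ρ))
          - p ρ * Real.exp (-W ρ)) := by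
          refine integral_mono hi4 (hi12.sub hi3) fun ρ => ?_
          have := mul_le_mul_of_nonneg_right (hpt ρ) (Real.exp_pos (-W ρ)).le
          simp only
          linarith
      _ = _ := by
          rw [integral_sub hi12 hi3, integral_add hi1 hi2, integral_const_mul,
            integral_const_mul, hp0, h.integral_inner_gradient_sub ρ₀]
          ring
  set D := {ρ | |p ρ| ≤ κ} with hD
  have hmeas : MeasurableSet D := measurableSet_le (by fun_prop) (by fun_prop)
  have hDV : ∫ ρ in D, Real.exp (-W ρ) ≤ V / 4 :=
    le_of_mul_le_mul_left ((h.setIntegral_slab_le hM hc hκ hθ).trans hκV) hc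
  have hlower : κ * V - κ * (V / 4) ≤ ∫ ρ, |p ρ| * Real.exp (-W ρ) := by
    have hi5 := h.integrable_exp.const_mul κ
    have hi6 : Integrable (D.indicator fun ρ => κ * Real.exp (-W ρ)) := hi5.indicator hmeas
    calc _ ≤ κ * V - κ * ∫ ρ in D, Real.exp (-W ρ) := by gcongr
      _ = ∫ ρ, (κ * Real.exp (-W ρ) - D.indicator (fun ρ => κ * Real.exp (-W ρ)) ρ) := by
          rw [integral_sub hi5 hi6, integral_indicator hmeas, integral_const_mul,
            integral_const_mul]
      _ ≤ _ := by
          refine integral_mono (hi5.sub hi6) hi4 fun ρ => ?_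
          simp only
          by_cases hρ : ρ ∈ D
          · rw [Set.indicator_of_mem hρ, sub_self]; positivity
          · rw [Set.indicator_of_notMem hρ, sub_zero]
            have : κ < |p ρ| := not_le.mp hρ
            gcongr
  have hTd : 2 * M / T * (d * V) ≤ κ / 4 * V := by
    have : 2 * M / T * (d * V) = κ / 4 * V * (d / (d + 1)) := by
      rw [hT]; field_simp; ring
    rw [this]
    have h2 : d / (d + 1) ≤ 1 := by rw [div_le_one (by positivity)]; linarith
    exact mul_le_of_le_one_right (by positivity) h2
  nlinarith [mul_pos hκ hV0]

end IsTamePotential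

/-- A tame potential whose density has controlled mass grows linearly away from its minimum, with
constants that depend only on the bounds. -/
theorem exists_linear_growth [MeasurableSpace E] [BorelSpace E] {M c₀ V₀ V₁ : ℝ}
    (hM : 0 < M) (hc : 0 < c₀) (hV₀ : 0 < V₀) (hV₁ : 0 < V₁) :
    ∃ ε > 0, ∃ C : ℝ, 0 ≤ C ∧ ∀ (W : E → ℝ) (g : E → E) (A : E → E →L[ℝ] E),
      IsTamePotential W g A M c₀ → V₀ ≤ ∫ ρ, Real.exp (-W ρ) → ∫ ρ, Real.exp (-W ρ) ≤ V₁ →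
      ∃ ρ₀, |W ρ₀| ≤ C ∧ ∀ ρ, ε * ‖ρ - ρ₀‖ - C ≤ W ρ := by
  set vM := (volume (Metric.closedBall (0 : E) (2 * M))).toReal with hvM
  have hvM0 : 0 ≤ vM := ENNReal.toReal_nonneg
  set κ := c₀ * M * V₀ / (4 * (vM + 1)) with hκ
  have hκ0 : 0 < κ := by positivity
  set T := 8 * M * (Module.finrank ℝ E + 1) / κ with hT
  have hT0 : 0 < T := by positivity
  have hε : 0 < κ / 8 := by positivity
  set I₁ := ∫ x : E, Real.exp (-(M * ‖x‖)) with hI₁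
  set I₂ := ∫ x : E, Real.exp (-(κ / 8 * ‖x‖)) with hI₂
  have hI₁0 : 0 < I₁ := integral_exp_neg_mul_norm_pos hM
  have hI₂0 : 0 < I₂ := integral_exp_neg_mul_norm_pos hε
  refine ⟨κ / 8, hε, |Real.log (V₁ / I₁)| + |T + Real.log (I₂ / V₀)| + T, by positivity, ?_⟩
  intro W g A h hV0 hV1
  obtain ⟨ρ₀, hmin⟩ := h.exists_isMin
  have hgrow : ∀ ρ, W ρ₀ + κ / 8 * ‖ρ - ρ₀‖ - T ≤ W ρ := by
    refine h.linear_growth hM hc hκ0 ?_ hmin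
    have h1 : κ / M * vM = c₀ * (V₀ / 4) * (vM / (vM + 1)) := by
      rw [hκ]; field_simp
    have h2 : vM / (vM + 1) ≤ 1 := by rw [div_le_one (by positivity)]; linarith
    rw [h1]
    refine (mul_le_of_le_one_right (by positivity) h2).trans ?_
    gcongr
  have hlow : -W ρ₀ ≤ Real.log (V₁ / I₁) := by
    rw [Real.le_log_iff_exp_le (by positivity), le_div_iff₀ hI₁0, hI₁,
      ← integral_sub_right_eq_self (fun x : E => Real.exp (-(M * ‖x‖))) ρ₀, ← integral_const_mul]
    refine le_trans (integral_mono ((integrable_exp_neg_mul_norm_sub hM ρ₀).const_mul _)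
      h.integrable_exp fun ρ => ?_) hV1
    simp only
    rw [← Real.exp_add, Real.exp_le_exp]
    linarith [h.le_min_add ρ₀ ρ]
  have hup : W ρ₀ ≤ T + Real.log (I₂ / V₀) := by
    have h1 : V₀ ≤ Real.exp (T - W ρ₀) * I₂ := by
      rw [hI₂, ← integral_sub_right_eq_self (fun x : E => Real.exp (-(κ / 8 * ‖x‖))) ρ₀,
        ← integral_const_mul]
      refine hV0.trans (integral_mono h.integrable_exp
        ((integrable_exp_neg_mul_norm_sub hε ρ₀).const_mul _) fun ρ => ?_)
      simp only
      rw [← Real.exp_add, Real.exp_le_exp]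
      linarith [hgrow ρ]
    have h2 : W ρ₀ - T ≤ Real.log (I₂ / V₀) := by
      rw [Real.le_log_iff_exp_le (by positivity), le_div_iff₀ hV₀]
      have h3 : Real.exp (W ρ₀ - T) * Real.exp (T - W ρ₀) = 1 := by
        rw [← Real.exp_add]; simp
      calc _ ≤ Real.exp (W ρ₀ - T) * (Real.exp (T - W ρ₀) * I₂) := by gcongr
        _ = I₂ := by rw [← mul_assoc, h3, one_mul]
    linarith
  have ha1 := le_abs_self (Real.log (V₁ / I₁))
  have ha2 := le_abs_self (T + Real.log (I₂ / V₀))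
  have hn1 := abs_nonneg (Real.log (V₁ / I₁))
  have hn2 := abs_nonneg (T + Real.log (I₂ / V₀))
  refine ⟨ρ₀, abs_le.mpr ⟨by linarith, by linarith⟩, fun ρ => ?_⟩
  linarith [hgrow ρ]

end LogConcave

/-! ### Bounds for Legendre transforms -/

section Legendre

variable {E : Type*} [NormedAddCommGroup E] [InnerProductSpace ℝ E] [FiniteDimensional ℝ E]
  [MeasurableSpace E] [BorelSpace E]

/-- If the image of `{R < ‖ρ‖}` under `T` is exponentially small, then some point `z` of `K` is such
that all points `x + 2⁻ᵏ (z - x)` come from balls whose radii grow linearly in `k`: the exceptional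
sets, rescaled by `2ᵏ`, have summable volumes with sum less than the volume of `K`. -/
theorem exists_forall_mem_image_ball {a C₁ v₀ : ℝ} (ha : 0 < a) (hC₁ : 0 ≤ C₁) (hv₀ : 0 < v₀)
    {T : E → E} {K : Set E} (hT : Set.range T = K) (hK : Convex ℝ K)
    (hvol : ENNReal.ofReal v₀ ≤ volume K)
    (htail : ∀ R : ℝ, volume (T '' {ρ | R < ‖ρ‖}) ≤ ENNReal.ofReal (C₁ * Real.exp (-(a * R))))
    {x : E} (hx : x ∈ K) :
    ∃ z ∈ K, ∀ k : ℕ, ∃ ρ, T ρ = x + ((1 / 2 : ℝ) ^ k) • (z - x) ∧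
      ‖ρ‖ ≤ |Real.log ((C₁ + 1) / v₀) / a| + (Module.finrank ℝ E + 1) * (k + 1) / a := by
  set d : ℕ := Module.finrank ℝ E with hd
  set r₁ := |Real.log ((C₁ + 1) / v₀) / a| with hr₁
  set R : ℕ → ℝ := fun k => r₁ + (d + 1) * (k + 1) / a with hR
  set y : E → ℕ → E := fun z k => x + ((1 / 2 : ℝ) ^ k) • (z - x) with hy
  have hyK : ∀ z ∈ K, ∀ k, y z k ∈ K := fun z hz k =>
    hK.add_smul_sub_mem hx hz ⟨by positivity, pow_le_one₀ (by norm_num) (by norm_num)⟩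
  by_contra! hcon
  set q := C₁ * Real.exp (-(a * r₁)) with hq
  have hq0 : 0 ≤ q := by positivity
  have hqv : q < v₀ := by
    have h1 : Real.log ((C₁ + 1) / v₀) ≤ a * r₁ := by
      calc _ = a * (Real.log ((C₁ + 1) / v₀) / a) := by field_simp
        _ ≤ _ := by rw [hr₁]; gcongr; exact le_abs_self _
    have h2 : Real.exp (-(a * r₁)) ≤ v₀ / (C₁ + 1) := by
      calc _ ≤ Real.exp (-Real.log ((C₁ + 1) / v₀)) := by gcongr
        _ = _ := by rw [← Real.log_inv, Real.exp_log (by positivity), inv_div]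
    calc q ≤ C₁ * (v₀ / (C₁ + 1)) := by rw [hq]; gcongr
      _ < v₀ := by
        rw [← mul_div_assoc, div_lt_iff₀ (by positivity)]
        nlinarith
  have hcover : K ⊆ ⋃ k : ℕ,
      AffineMap.homothety x ((2 : ℝ) ^ k) '' (T '' {ρ | R k < ‖ρ‖}) := by
    intro z hz
    obtain ⟨k, hk⟩ := hcon z hz
    obtain ⟨ρ, hρ⟩ : y z k ∈ Set.range T := hT ▸ hyK z hz k
    refine Set.mem_iUnion.mpr ⟨k, y z k, ⟨ρ, hk ρ hρ, hρ⟩, ?_⟩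
    simp only [AffineMap.homothety_apply, vsub_eq_sub, vadd_eq_add, hy, add_sub_cancel_left,
      smul_smul, ← mul_pow]
    norm_num
  -- The radius `R k` compensates the factor `2 ^ (k * d)` by which the rescaling increases volume.
  have hterm : ∀ k : ℕ, volume (AffineMap.homothety x ((2 : ℝ) ^ k) '' (T '' {ρ | R k < ‖ρ‖})) ≤
      ENNReal.ofReal q * 2⁻¹ ^ (k + 1) := by
    intro k
    rw [Measure.addHaar_image_homothety]
    have h2 : (2⁻¹ : ENNReal) ^ (k + 1) = ENNReal.ofReal ((1 / 2) ^ (k + 1)) := by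
      rw [ENNReal.ofReal_pow (by norm_num), one_div, ENNReal.ofReal_inv_of_pos (by norm_num)]
      simp
    rw [h2, ← ENNReal.ofReal_mul hq0]
    refine (mul_le_mul_right (htail (R k)) _).trans ?_
    rw [← ENNReal.ofReal_mul (by positivity)]
    refine ENNReal.ofReal_le_ofReal ?_
    rw [abs_of_pos (by positivity)]
    have h3 : Real.exp (-(a * R k)) = Real.exp (-(a * r₁)) *
        Real.exp (-1) ^ ((d + 1) * (k + 1)) := by
      rw [← Real.exp_nat_mul, ← Real.exp_add]
      congr 1
      simp only [hR]
      push_cast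
      field_simp
      ring
    have h4 : Real.exp (-1) ≤ 1 / 2 := by
      rw [Real.exp_neg, one_div]
      exact inv_anti₀ two_pos (by linarith [Real.add_one_le_exp 1])
    have h5 : ((2 : ℝ) ^ k) ^ d * (1 / 2) ^ ((d + 1) * (k + 1)) ≤ (1 / 2) ^ (k + 1) := by
      have e : ((2 : ℝ) ^ k) ^ d * (1 / 2) ^ ((d + 1) * (k + 1)) =
          (2 ^ (k * d) * (1 / 2 : ℝ) ^ (k * d)) * (1 / 2) ^ d * (1 / 2) ^ (k + 1) := by ring
      rw [e]
      have : (2 : ℝ) ^ (k * d) * (1 / 2) ^ (k * d) = 1 := by rw [← mul_pow]; norm_num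
      rw [this, one_mul]
      exact mul_le_of_le_one_left (by positivity) (pow_le_one₀ (by norm_num) (by norm_num))
    calc _ = q * (((2 : ℝ) ^ k) ^ d * Real.exp (-1) ^ ((d + 1) * (k + 1))) := by
          rw [h3, hq]; ring
      _ ≤ q * (((2 : ℝ) ^ k) ^ d * (1 / 2) ^ ((d + 1) * (k + 1))) := by gcongr
      _ ≤ _ := by gcongr
  have hsum : volume K ≤ ENNReal.ofReal q := by
    calc volume K ≤ _ := measure_mono hcover
      _ ≤ _ := measure_iUnion_le _
      _ ≤ ∑' k : ℕ, ENNReal.ofReal q * 2⁻¹ ^ (k + 1) := ENNReal.tsum_le_tsum hterm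
      _ = ENNReal.ofReal q := by
        rw [ENNReal.tsum_mul_left, ENNReal.tsum_geometric_add_one]
        simp [ENNReal.one_sub_inv_two, ENNReal.inv_mul_cancel]
  have := (ENNReal.ofReal_le_ofReal_iff hq0).mp (hvol.trans hsum)
  linarith

/-- A convex function whose gradient map has exponentially small tails has a Legendre transform that
is bounded above on the gradient image. Along the chain of points `x + 2⁻ᵏ (z - x)` the transform
increases by at most a radius times a step, and these products are summable. -/
theorem exists_legendre_le {a C₀ C₁ v₀ σ : ℝ} (ha : 0 < a) (hC₁ : 0 ≤ C₁) (hv₀ : 0 < v₀)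
    (hσ : 0 ≤ σ) :
    ∃ C : ℝ, ∀ (φ : E → ℝ) (T : E → E) (K : Set E), Set.range T = K → Convex ℝ K →
      ENNReal.ofReal v₀ ≤ volume K → (∀ x ∈ K, ‖x‖ ≤ σ) →
      (∀ ρ ρ', φ ρ + ⟪T ρ, ρ' - ρ⟫ ≤ φ ρ') →
      (∀ R : ℝ, volume (T '' {ρ | R < ‖ρ‖}) ≤ ENNReal.ofReal (C₁ * Real.exp (-(a * R)))) →
      |φ 0| ≤ C₀ → ∀ x ∈ K, ∀ ρ, ⟪x, ρ⟫ - φ ρ ≤ C := by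
  set d : ℕ := Module.finrank ℝ E with hd
  set r₁ := |Real.log ((C₁ + 1) / v₀) / a| with hr₁
  set q : ℝ := (d + 1) / a with hq
  have hq0 : 0 ≤ q := by positivity
  set p : ℝ := r₁ + 2 * q with hp
  refine ⟨2 * σ * (r₁ + q) + C₀ + σ * (2 * p + 2 * q), ?_⟩
  intro φ T K hT hK hvol hbd hsub htail hφ0 x hx ρ
  obtain ⟨z, hz, hchain⟩ := exists_forall_mem_image_ball ha hC₁ hv₀ hT hK hvol htail hx
  choose ρk hρk hnorm using hchain
  have hTσ : ∀ ρ, ‖T ρ‖ ≤ σ := fun ρ => hbd _ (hT ▸ Set.mem_range_self ρ)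
  have hR : ∀ k : ℕ, ‖ρk k‖ ≤ r₁ + q * (k + 1) := fun k => by
    have := hnorm k
    rwa [mul_div_right_comm] at this
  set u : ℕ → ℝ := fun k => ⟪T (ρk k), ρk k⟫ - φ (ρk k) with hu
  have hzx : ‖z - x‖ ≤ 2 * σ := by
    have := norm_sub_le z x
    linarith [hbd z hz, hbd x hx]
  have hstep : ∀ k : ℕ, u (k + 1) ≤ u k + (1 / 2) ^ k * σ * (p + q * k) := by
    intro k
    have h1 := hsub (ρk k) (ρk (k + 1))
    have h2 : T (ρk (k + 1)) - T (ρk k) = (-(1 / 2 : ℝ) ^ (k + 1)) • (z - x) := by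
      rw [hρk, hρk, pow_succ]; module
    have h3 : ⟪T (ρk (k + 1)) - T (ρk k), ρk (k + 1)⟫ ≤ (1 / 2) ^ k * σ * (p + q * k) := by
      refine (real_inner_le_norm _ _).trans ?_
      rw [h2, norm_smul, norm_neg, norm_pow, Real.norm_eq_abs, abs_of_pos (by norm_num)]
      calc _ ≤ ((1 / 2) ^ (k + 1) * (2 * σ)) * (r₁ + q * ((k + 1 : ℕ) + 1)) := by
            gcongr
            exact hR (k + 1)
        _ = _ := by rw [hp]; push_cast; ring
    rw [inner_sub_left] at h3
    rw [inner_sub_right] at h1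
    simp only [hu]
    linarith
  -- The added term telescopes the increments `2⁻ᵏ σ (p + q k)`.
  have hbound : ∀ k : ℕ, u k + σ * ((1 / 2) ^ k * (2 * p + 2 * q + 2 * q * k)) ≤
      u 0 + σ * (2 * p + 2 * q) := by
    intro k
    induction k with
    | zero => simp
    | succ k ih =>
      refine le_trans ?_ ih
      have h1 := hstep k
      have e : σ * ((1 / 2) ^ k * (2 * p + 2 * q + 2 * q * k)) =
          (1 / 2) ^ k * σ * (p + q * k) +
          σ * ((1 / 2) ^ (k + 1) * (2 * p + 2 * q + 2 * q * ((k + 1 : ℕ) : ℝ))) := by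
        push_cast; ring
      linarith
  have hu0 : u 0 ≤ 2 * σ * (r₁ + q) + C₀ := by
    have h1 := hsub 0 (ρk 0)
    have h2 : ‖ρk 0‖ ≤ r₁ + q := by simpa using hR 0
    have h3 := real_inner_le_norm (T (ρk 0)) (ρk 0)
    have h4 := (abs_le.mp (abs_real_inner_le_norm (T 0) (ρk 0))).1
    have h5 : ‖T (ρk 0)‖ * ‖ρk 0‖ ≤ σ * (r₁ + q) := by gcongr; exact hTσ _
    have h6 : ‖T 0‖ * ‖ρk 0‖ ≤ σ * (r₁ + q) := by gcongr; exact hTσ _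
    rw [sub_zero] at h1
    simp only [hu]
    linarith [(abs_le.mp hφ0).1]
  have hall : ∀ k : ℕ, ⟪x, ρ⟫ - φ ρ ≤
      2 * σ * (r₁ + q) + C₀ + σ * (2 * p + 2 * q) + (1 / 2) ^ k * (2 * σ * ‖ρ‖) := by
    intro k
    have h1 := hsub (ρk k) ρ
    have h2 : x = T (ρk k) + (-(1 / 2 : ℝ) ^ k) • (z - x) := by
      rw [hρk]; module
    have h3 : ⟪x, ρ⟫ ≤ ⟪T (ρk k), ρ⟫ + (1 / 2) ^ k * (2 * σ * ‖ρ‖) := by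
      conv_lhs => rw [h2]
      rw [inner_add_left]
      gcongr
      refine (real_inner_le_norm _ _).trans ?_
      rw [norm_smul, norm_neg, norm_pow, Real.norm_eq_abs, abs_of_pos (by norm_num), mul_assoc]
      gcongr
    have h4 := hbound k
    have h5 : 0 ≤ σ * ((1 / 2) ^ k * (2 * p + 2 * q + 2 * q * k)) := by positivity
    rw [inner_sub_right] at h1
    simp only [hu] at h4 hu0
    linarith
  have hlim : Filter.Tendsto (fun k : ℕ => 2 * σ * (r₁ + q) + C₀ + σ * (2 * p + 2 * q) +
      (1 / 2 : ℝ) ^ k * (2 * σ * ‖ρ‖)) Filter.atTop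
      (nhds (2 * σ * (r₁ + q) + C₀ + σ * (2 * p + 2 * q) + 0 * (2 * σ * ‖ρ‖))) :=
    tendsto_const_nhds.add ((tendsto_pow_atTop_nhds_zero_of_lt_one (by norm_num)
      (by norm_num)).mul_const _)
  have := ge_of_tendsto' hlim hall
  simpa using this

end Legendre

/-! ### The gradient map and the Hessian -/

section Hessian

variable {n : ℕ}

/-- The determinant inequality for an operator whose matrix in the standard basis is positive
definite. -/
theorem det_le_det_add_of_isPositive {A B : EuclideanSpace ℝ (Fin n) →L[ℝ] EuclideanSpace ℝ (Fin n)}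
    (hA : (LinearMap.toMatrix (EuclideanSpace.basisFun (Fin n) ℝ).toBasis
      (EuclideanSpace.basisFun (Fin n) ℝ).toBasis A.toLinearMap).PosDef)
    (hB : B.toLinearMap.IsPositive) : A.det ≤ (A + B).det := by
  have hB' := (LinearMap.posSemidef_toMatrix_iff (EuclideanSpace.basisFun (Fin n) ℝ)).mpr hB
  have h := det_le_det_add_of_posSemidef hA hB'
  rw [← map_add, LinearMap.det_toMatrix, LinearMap.det_toMatrix] at h
  exact h

variable {φ : EuclideanSpace ℝ (Fin n) → ℝ}

theorem hasGradientAt_of_contDiff (hφ : ContDiff ℝ ∞ φ) (ρ : EuclideanSpace ℝ (Fin n)) :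
    HasGradientAt φ (gradient φ ρ) ρ :=
  (hφ.differentiable (by simp)).differentiableAt.hasGradientAt

theorem hasFDerivAt_gradient (hφ : ContDiff ℝ ∞ φ) (ρ : EuclideanSpace ℝ (Fin n)) :
    HasFDerivAt (gradient φ) (fderiv ℝ (gradient φ) ρ) ρ := by
  have h1 : ContDiff ℝ 1 (fderiv ℝ φ) := hφ.fderiv_right (by norm_cast)
  have h2 : Differentiable ℝ (gradient φ) :=
    (InnerProductSpace.toDual ℝ _).symm.toContinuousLinearEquiv.differentiable.comp
      (h1.differentiable (by simp))
  exact (h2 ρ).hasFDerivAt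

/-- The matrix of the derivative of the gradient map is the Hessian matrix. -/
theorem toMatrix_fderiv_gradient (hφ : ContDiff ℝ ∞ φ) (ρ : EuclideanSpace ℝ (Fin n)) :
    LinearMap.toMatrix (EuclideanSpace.basisFun (Fin n) ℝ).toBasis
      (EuclideanSpace.basisFun (Fin n) ℝ).toBasis (fderiv ℝ (gradient φ) ρ).toLinearMap =
      hessian φ ρ := by
  ext i j
  have h1 : (fun y => fderiv ℝ φ y (EuclideanSpace.single i 1)) =
      fun y => ⟪EuclideanSpace.single i (1 : ℝ), gradient φ y⟫ := by
    funext y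
    rw [(hasGradientAt_of_contDiff hφ y).hasFDerivAt.fderiv, real_inner_comm]
    rfl
  have h2 : HasFDerivAt (fun y => ⟪EuclideanSpace.single i (1 : ℝ), gradient φ y⟫)
      ((innerSL ℝ (EuclideanSpace.single i (1 : ℝ))).comp (fderiv ℝ (gradient φ) ρ)) ρ :=
    (innerSL ℝ (EuclideanSpace.single i (1 : ℝ))).hasFDerivAt.comp ρ (hasFDerivAt_gradient hφ ρ)
  simp only [hessian, Matrix.of_apply]
  rw [h1, h2.fderiv, LinearMap.toMatrix_apply]
  simp [EuclideanSpace.inner_single_left]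

theorem inner_fderiv_gradient_pos (hφ : ContDiff ℝ ∞ φ) (hH : ∀ ρ, (hessian φ ρ).PosDef)
    (ρ w : EuclideanSpace ℝ (Fin n)) (hw : w ≠ 0) : 0 < ⟪fderiv ℝ (gradient φ) ρ w, w⟫ := by
  have hw' : w.ofLp ≠ 0 := fun h => hw (by ext i; simp [h])
  have h := (hH ρ).re_dotProduct_pos hw'
  rw [← toMatrix_fderiv_gradient hφ ρ] at h
  have h2 := LinearMap.toMatrix_mulVec_repr (EuclideanSpace.basisFun (Fin n) ℝ).toBasis
      (EuclideanSpace.basisFun (Fin n) ℝ).toBasis (fderiv ℝ (gradient φ) ρ).toLinearMap w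
  have h3 : ∀ y : EuclideanSpace ℝ (Fin n),
      ⇑((EuclideanSpace.basisFun (Fin n) ℝ).toBasis.repr y) = y.ofLp := fun y => by
    ext i; simp
  rw [h3, h3] at h2
  rw [h2] at h
  rw [EuclideanSpace.inner_eq_star_dotProduct, dotProduct_comm]
  simpa [dotProduct_comm] using h

end Hessian

namespace DelzantPolytope

/-! ### Uniform bounds for the polytope data -/

variable {n N : ℕ} (P : DelzantPolytope n N)

theorem measurableSet_carrier : MeasurableSet P.carrier := P.isOpen_carrier.measurableSet

theorem integrableOn_carrier {F : Type*} [NormedAddCommGroup F]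
    {f : EuclideanSpace ℝ (Fin n) → F} (hf : Continuous f) : IntegrableOn f P.carrier :=
  (hf.continuousOn.integrableOn_compact P.isBounded_carrier.isCompact_closure).mono_set
    subset_closure

theorem volume_carrier_pos : 0 < volume P.carrier :=
  P.isOpen_carrier.measure_pos volume P.carrier_nonempty

theorem integral_exp_inner_pos (c : EuclideanSpace ℝ (Fin n)) :
    0 < ∫ x in P.carrier, Real.exp ⟪c, x⟫ := by
  have : NeZero (volume.restrict P.carrier) :=
    ⟨fun h => P.volume_carrier_pos.ne' (Measure.restrict_eq_zero.mp h)⟩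
  exact integral_exp_pos (P.integrableOn_carrier (f := fun x => Real.exp ⟪c, x⟫) (by fun_prop))

/-- The barycenter condition in scalar form. -/
theorem IsCompatible.integral_inner_eq_zero {P : DelzantPolytope n N}
    {τ c : EuclideanSpace ℝ (Fin n)} (h : P.IsCompatible τ c) (v : EuclideanSpace ℝ (Fin n)) :
    ∫ x in P.carrier, ⟪v, x - τ⟫ * Real.exp ⟪c, x⟫ = 0 := by
  have hJ := P.integral_exp_inner_pos c
  set J := ∫ x in P.carrier, Real.exp ⟪c, x⟫ with hJdef
  have h1 : J • τ = ∫ x in P.carrier, Real.exp ⟪c, x⟫ • x := by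
    rw [h, smul_smul, mul_inv_cancel₀ hJ.ne', one_smul]
  have hi := P.integrableOn_carrier (f := fun x => Real.exp ⟪c, x⟫ • x) (by fun_prop)
  have h2 : ∫ x in P.carrier, ⟪v, Real.exp ⟪c, x⟫ • x⟫ = ⟪v, J • τ⟫ := by
    rw [h1]; exact integral_inner hi v
  have e : ∀ x : EuclideanSpace ℝ (Fin n), ⟪v, x - τ⟫ * Real.exp ⟪c, x⟫ =
      ⟪v, Real.exp ⟪c, x⟫ • x⟫ - ⟪v, τ⟫ * Real.exp ⟪c, x⟫ := fun x => by
    rw [inner_sub_right, inner_smul_right]; ring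
  simp only [e]
  rw [integral_sub (P.integrableOn_carrier (by fun_prop)) (P.integrableOn_carrier (by fun_prop)),
    h2, integral_const_mul, inner_smul_right]
  ring

/-- The barycenter for an exponential density is close to the part of the polytope where the density
is largest. This follows by comparing the mass with that of the polytope shrunk by the factor `1/2`
towards `x₀`. -/
theorem IsCompatible.inner_sub_le {P : DelzantPolytope n N} {τ c : EuclideanSpace ℝ (Fin n)}
    (h : P.IsCompatible τ c) {x₀ : EuclideanSpace ℝ (Fin n)} (hx₀ : x₀ ∈ P.carrier) :
    ⟪c, x₀ - τ⟫ ≤ 2 ^ (n + 1) := by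
  have hJ := P.integral_exp_inner_pos c
  set J := ∫ x in P.carrier, Real.exp ⟪c, x⟫ with hJdef
  set f : EuclideanSpace ℝ (Fin n) → EuclideanSpace ℝ (Fin n) :=
    fun x => x₀ + (1 / 2 : ℝ) • (x - x₀) with hf
  have hder : ∀ x, HasFDerivAt f
      ((1 / 2 : ℝ) • ContinuousLinearMap.id ℝ (EuclideanSpace ℝ (Fin n))) x := fun x =>
    (((hasFDerivAt_id x).sub_const x₀).const_smul (1 / 2 : ℝ)).const_add x₀
  have hinj : Set.InjOn f P.carrier := by
    intro x _ y _ hxy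
    simpa [hf] using hxy
  have hsub : f '' P.carrier ⊆ P.carrier := by
    rintro _ ⟨x, hx, rfl⟩
    exact P.convex_carrier.add_smul_sub_mem hx₀ hx ⟨by norm_num, by norm_num⟩
  have hdet : ((1 / 2 : ℝ) • ContinuousLinearMap.id ℝ (EuclideanSpace ℝ (Fin n))).det =
      (1 / 2) ^ n := by
    simp [ContinuousLinearMap.det]
  have h1 := integral_image_eq_integral_abs_det_fderiv_smul volume P.measurableSet_carrier
    (fun x _ => (hder x).hasFDerivWithinAt) hinj (fun x => Real.exp ⟪c, x⟫)
  have h2 : ∫ x in f '' P.carrier, Real.exp ⟪c, x⟫ ≤ J :=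
    setIntegral_mono_set (P.integrableOn_carrier (by fun_prop))
      (Filter.Eventually.of_forall fun x => (Real.exp_pos _).le) hsub.eventuallyLE
  simp only [hdet, smul_eq_mul] at h1
  rw [h1, integral_const_mul, abs_of_pos (by positivity)] at h2
  have h3 : ∫ x in P.carrier, ((1 + ⟪c, x₀ - τ⟫ / 2) * Real.exp ⟪c, x⟫
      - 1 / 2 * (⟪c, x - τ⟫ * Real.exp ⟪c, x⟫)) ≤ ∫ x in P.carrier, Real.exp ⟪c, f x⟫ := by
    refine integral_mono (P.integrableOn_carrier (by fun_prop))
      (P.integrableOn_carrier (by simp only [hf]; fun_prop)) fun x => ?_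
    have e1 : ⟪c, f x⟫ = ⟪c, x⟫ + (⟪c, x₀ - τ⟫ / 2 - 1 / 2 * ⟪c, x - τ⟫) := by
      simp only [hf, inner_add_right, inner_smul_right, inner_sub_right]; ring
    simp only
    rw [e1, Real.exp_add]
    have h4 := Real.add_one_le_exp (⟪c, x₀ - τ⟫ / 2 - 1 / 2 * ⟪c, x - τ⟫)
    have h5 := mul_le_mul_of_nonneg_left h4 (Real.exp_pos ⟪c, x⟫).le
    linarith
  rw [integral_sub (P.integrableOn_carrier (by fun_prop)) (P.integrableOn_carrier (by fun_prop)),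
    integral_const_mul, integral_const_mul, h.integral_inner_eq_zero] at h3
  have h6 : (1 / 2 : ℝ) ^ n * ((1 + ⟪c, x₀ - τ⟫ / 2) * J) ≤ J :=
    le_trans (by gcongr; simpa using h3) h2
  have h7 : (1 / 2 : ℝ) ^ n * (1 + ⟪c, x₀ - τ⟫ / 2) ≤ 1 := by
    refine le_of_mul_le_mul_right ?_ hJ
    linarith
  have h8 : (2 : ℝ) ^ n * ((1 / 2 : ℝ) ^ n * (1 + ⟪c, x₀ - τ⟫ / 2)) ≤ 2 ^ n * 1 := by gcongr
  have h9 : (2 : ℝ) ^ n * (1 / 2) ^ n = 1 := by rw [← mul_pow]; norm_num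
  rw [← mul_assoc, h9] at h8
  rw [pow_succ]
  linarith

theorem IsCompatible.norm_le {P : DelzantPolytope n N} {τ c : EuclideanSpace ℝ (Fin n)}
    (h : P.IsCompatible τ c) {r : ℝ} (hr : 0 < r) (hball : Metric.closedBall τ r ⊆ P.carrier) :
    ‖c‖ ≤ 2 ^ (n + 1) / r := by
  rcases eq_or_ne c 0 with rfl | hc
  · rw [norm_zero]; positivity
  have hn : 0 < ‖c‖ := norm_pos_iff.mpr hc
  have hmem : τ + (r / ‖c‖) • c ∈ P.carrier := by
    refine hball ?_
    rw [mem_closedBall_iff_norm, add_sub_cancel_left, norm_smul, norm_div, norm_norm,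
      Real.norm_of_nonneg hr.le, div_mul_cancel₀ _ hn.ne']
  have h1 := h.inner_sub_le hmem
  rw [add_sub_cancel_left, inner_smul_right, real_inner_self_eq_norm_sq] at h1
  rw [le_div_iff₀ hr]
  calc ‖c‖ * r = r / ‖c‖ * ‖c‖ ^ 2 := by field_simp
    _ ≤ _ := h1

/-- A long normal vector would confine the polytope to a thin slab, of small volume. -/
theorem norm_normal_le {ν σ L : ℝ} (hν : 0 < ν) (hσ : 0 < σ) (hL : 0 < L)
    (hvol : ν⁻¹ < (volume P.carrier).toReal) (hbd : ∀ x ∈ P.carrier, ‖x‖ ≤ σ) (j : Fin N)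
    (hl : ∀ x ∈ P.carrier, |P.l j x| ≤ L) :
    ‖P.normal j‖ ≤ L / σ * ν *
      (volume (Metric.closedBall (0 : EuclideanSpace ℝ (Fin n)) (2 * σ))).toReal := by
  set vB := (volume (Metric.closedBall (0 : EuclideanSpace ℝ (Fin n)) (2 * σ))).toReal with hvB
  rcases eq_or_ne (P.normal j) 0 with h0 | h0
  · rw [h0, norm_zero]
    have : 0 ≤ vB := ENNReal.toReal_nonneg
    positivity
  have hn : 0 < ‖P.normal j‖ := norm_pos_iff.mpr h0
  have h1 := volume_le_of_subset_slab (S := P.carrier) (M := σ) (κ := L / ‖P.normal j‖)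
    (a := -P.lam j / ‖P.normal j‖) (θ := ‖P.normal j‖⁻¹ • P.normal j) hσ (by positivity)
    (by rw [norm_smul, norm_inv, norm_norm, inv_mul_cancel₀ hn.ne']) (fun x hx => ⟨hbd x hx, ?_⟩)
  · have h2 := ENNReal.toReal_mono
      (ENNReal.mul_ne_top ENNReal.ofReal_ne_top measure_closedBall_lt_top.ne) h1
    rw [ENNReal.toReal_mul, ENNReal.toReal_ofReal (by positivity), ← hvB] at h2
    have h3 := hvol.trans_le h2
    rw [inv_lt_iff_one_lt_mul₀ hν] at h3
    have e : ‖P.normal j‖ * (ν * (L / ‖P.normal j‖ / σ * vB)) = L / σ * ν * vB := by field_simp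
    nlinarith
  · have e : ⟪‖P.normal j‖⁻¹ • P.normal j, x⟫ - -P.lam j / ‖P.normal j‖ =
        P.l j x / ‖P.normal j‖ := by
      rw [P.l_eq_inner, inner_smul_left]
      simp only [RCLike.conj_to_real]
      ring
    rw [e, abs_div, abs_of_pos hn]
    gcongr
    exact hl x hx

theorem closedBall_subset_carrier {τ : EuclideanSpace ℝ (Fin n)} {K δ : ℝ} (hK : 0 ≤ K)
    (hδ : 0 < δ) (hnormal : ∀ j, ‖P.normal j‖ ≤ K) (hτ : ∀ j, δ ≤ P.l j τ) :
    Metric.closedBall τ (δ / (K + 1)) ⊆ P.carrier := by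
  intro x hx j
  rw [mem_closedBall_iff_norm] at hx
  have h1 := P.l_sub j τ x
  have h2 := (abs_le.mp (abs_real_inner_le_norm (P.normal j) (x - τ))).1
  have h3 : ‖P.normal j‖ * ‖x - τ‖ ≤ K * (δ / (K + 1)) := by gcongr; exact hnormal j
  have h4 : K * (δ / (K + 1)) < δ := by
    rw [← mul_div_assoc, div_lt_iff₀ (by positivity)]; nlinarith
  linarith [hτ j]

/-- Distinct facets have distinct normals, since both of them are not empty. -/
theorem injective_v : Function.Injective P.v := by
  intro j k hjk
  by_contra hne
  obtain ⟨x, hx0, hx⟩ := P.facet j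
  obtain ⟨y, hy0, hy⟩ := P.facet k
  have h1 := hx k (Ne.symm hne)
  have h2 := hy j hne
  rw [hjk] at hx0 h2
  linarith

/-- There are only finitely many integral vectors of bounded length. -/
theorem card_facets_le {K : ℝ} (hnormal : ∀ j, ‖P.normal j‖ ≤ K) :
    N ≤ (2 * ⌊K⌋₊ + 1) ^ n := by
  set S : Finset (Fin n → ℤ) :=
    Fintype.piFinset fun _ => Finset.Icc (-(⌊K⌋₊ : ℤ)) (⌊K⌋₊ : ℤ) with hS
  have hmem : ∀ j ∈ (Finset.univ : Finset (Fin N)), P.v j ∈ S := by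
    intro j _
    rw [hS, Fintype.mem_piFinset]
    intro i
    have h1 : ‖P.normal j i‖ ≤ K := (PiLp.norm_apply_le (P.normal j) i).trans (hnormal j)
    have h2 : ((P.v j i).natAbs : ℝ) ≤ K := by
      rw [Nat.cast_natAbs, Int.cast_abs]
      exact h1
    have h3 := Nat.le_floor h2
    rw [Finset.mem_Icc]
    omega
  have h := Finset.card_le_card_of_injOn P.v hmem P.injective_v.injOn
  rw [Finset.card_univ, Fintype.card_fin] at h
  refine h.trans (le_of_eq ?_)
  rw [hS, Fintype.card_piFinset_const, Int.card_Icc]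
  congr 1
  omega

theorem abs_refSymplectic_le {β : Fin N → ℝ} {b L : ℝ} (hb : 0 < b) (hβ : ∀ j, b ≤ β j)
    {x : EuclideanSpace ℝ (Fin n)} (hx : x ∈ P.carrier) (hl : ∀ j, P.l j x ≤ L) :
    |P.refSymplectic β x| ≤ N * ((1 + L ^ 2) / b) := by
  refine (Finset.abs_sum_le_sum_abs _ _).trans ?_
  refine (Finset.sum_le_card_nsmul _ _ ((1 + L ^ 2) / b) fun j _ => ?_).trans (by simp)
  rw [abs_div, abs_of_pos (hb.trans_le (hβ j))]
  exact div_le_div₀ (by positivity) (abs_mul_log_le (hx j) (hl j)) hb (hβ j)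

theorem nonempty_facets_of_diam_pos (hdiam : 0 < Metric.diam P.carrier) : Nonempty (Fin N) := by
  by_contra hN
  rw [not_nonempty_iff] at hN
  refine hdiam.ne' (Metric.diam_subsingleton fun x _ y _ => ?_)
  rw [← sub_eq_zero]
  exact P.eq_zero_of_forall_inner_normal_eq_zero fun j => isEmptyElim j

/-- All the quantities on which the estimates depend are bounded by the given constants. The
constant `K` bounds the cone angle factor, the normals, the number of facets, the vector `c` and the
reference symplectic potential, and `r` is the radius of a ball about `τ` inside the polytope. -/
structure IsControlled (P : DelzantPolytope n N) (α : ℝ) (τ c : EuclideanSpace ℝ (Fin n))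
    (s₀ ν σ Λ L δ K r : ℝ) : Prop where
  lt_alpha : s₀ < α
  mem : τ ∈ P.carrier
  compatible : P.IsCompatible τ c
  lt_volume : ν⁻¹ < (volume P.carrier).toReal
  volume_lt : (volume P.carrier).toReal < ν
  norm_le : ∀ x ∈ P.carrier, ‖x‖ ≤ σ
  l_le : ∀ j, ∀ x ∈ P.carrier, P.l j x ≤ L
  le_l : ∀ j, δ ≤ P.l j τ
  gradientBound : P.IsGradientBound (P.beta α τ) Λ
  alpha_le : α ≤ K
  norm_normal_le : ∀ j, ‖P.normal j‖ ≤ K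
  facets_le : (N : ℝ) ≤ K
  norm_c_le : ‖c‖ ≤ K
  ball_subset : Metric.closedBall τ r ⊆ P.carrier
  abs_refSymplectic_le : ∀ x ∈ P.carrier, |P.refSymplectic (P.beta α τ) x| ≤ K

theorem exists_isControlled (n : ℕ) {s₀ ν σ L δ : ℝ} (hs₀ : 0 < s₀) (hν : 0 < ν) (hσ : 0 < σ)
    (hL : 0 < L) (hδ : 0 < δ) :
    ∃ K > 0, ∃ r > 0, ∀ (N : ℕ) (P : DelzantPolytope n N) (α : ℝ)
      (τ c : EuclideanSpace ℝ (Fin n)) (Λ : ℝ),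
      s₀ < α → τ ∈ P.carrier → (∀ j, 0 < 1 - α * P.l j τ) → P.IsCompatible τ c →
      ν⁻¹ < (volume P.carrier).toReal → (volume P.carrier).toReal < ν →
      0 < Metric.diam P.carrier →
      (∀ x ∈ P.carrier, ‖x‖ ≤ σ) →
      (∀ j, ∀ x ∈ P.carrier, |P.l j x| ≤ L) →
      (∀ j, δ ≤ P.l j τ) →
      P.IsGradientBound (P.beta α τ) Λ →
      P.IsControlled α τ c s₀ ν σ Λ L δ K r := by
  set K₁ := L / σ * ν *
    (volume (Metric.closedBall (0 : EuclideanSpace ℝ (Fin n)) (2 * σ))).toReal with hK₁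
  have hK₁0 : 0 ≤ K₁ := mul_nonneg (by positivity) ENNReal.toReal_nonneg
  set r := δ / (K₁ + 1) with hr
  have hr0 : 0 < r := by positivity
  set N₁ : ℝ := (((2 * ⌊K₁⌋₊ + 1) ^ n : ℕ) : ℝ) with hN₁
  have hN₁0 : 0 ≤ N₁ := Nat.cast_nonneg _
  set u := N₁ * ((1 + L ^ 2) / (s₀ * δ)) with hu
  have hu0 : 0 ≤ u := by positivity
  have hc0 : (0 : ℝ) < 2 ^ (n + 1) / r := by positivity
  have hδ0 : 0 < 1 / δ := by positivity
  refine ⟨K₁ + N₁ + u + 2 ^ (n + 1) / r + 1 / δ, by positivity, r, hr0, ?_⟩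
  intro N P α τ c Λ hα hτ hone hcomp hv1 hv2 hdiam hbd hl hτδ hΛ
  have hnormal : ∀ j, ‖P.normal j‖ ≤ K₁ := fun j =>
    P.norm_normal_le hν hσ hL hv1 hbd j (hl j)
  have hball : Metric.closedBall τ r ⊆ P.carrier :=
    P.closedBall_subset_carrier hK₁0 hδ hnormal hτδ
  have hN : (N : ℝ) ≤ N₁ := by
    rw [hN₁]
    exact_mod_cast P.card_facets_le hnormal
  have hc := hcomp.norm_le hr0 hball
  have hα1 : α ≤ 1 / δ := by
    obtain ⟨j⟩ := P.nonempty_facets_of_diam_pos hdiam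
    rw [le_div_iff₀ hδ]
    have h1 : α * δ ≤ α * P.l j τ := by
      have : 0 < α := hs₀.trans hα
      gcongr
      exact hτδ j
    linarith [hone j]
  have hll : ∀ j, ∀ x ∈ P.carrier, P.l j x ≤ L := fun j x hx => (le_abs_self _).trans (hl j x hx)
  have hβ : ∀ j, s₀ * δ ≤ P.beta α τ j := fun j =>
    mul_le_mul hα.le (hτδ j) hδ.le (hs₀.trans hα).le
  refine ⟨hα, hτ, hcomp, hv1, hv2, hbd, hll, hτδ, hΛ, by linarith,
    fun j => by linarith [hnormal j], by linarith, by linarith, hball, fun x hx => ?_⟩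
  have h1 := P.abs_refSymplectic_le (mul_pos hs₀ hδ) hβ hx fun j => hll j x hx
  have h2 : N * ((1 + L ^ 2) / (s₀ * δ)) ≤ u := by rw [hu]; gcongr
  linarith

end DelzantPolytope

/-! ### The continuity path -/

section Path

variable {n N : ℕ}

/-- The convex function `s (φ - τ · ρ) + (α - s) (φhat - τ · ρ)` in the exponent of the equation. -/
noncomputable def pathPotential (P : DelzantPolytope n N) (α : ℝ) (τ : EuclideanSpace ℝ (Fin n))
    (s : ℝ) (φ : EuclideanSpace ℝ (Fin n) → ℝ) (ρ : EuclideanSpace ℝ (Fin n)) : ℝ :=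
  s * (φ ρ - ⟪τ, ρ⟫) + (α - s) * (P.refPotential (P.beta α τ) ρ - ⟪τ, ρ⟫)

/-- The gradient of `pathPotential`. -/
noncomputable def pathGradient (P : DelzantPolytope n N) (α : ℝ) (τ : EuclideanSpace ℝ (Fin n))
    (s : ℝ) (φ : EuclideanSpace ℝ (Fin n) → ℝ) (ρ : EuclideanSpace ℝ (Fin n)) :
    EuclideanSpace ℝ (Fin n) :=
  s • (gradient φ ρ - τ) + (α - s) • (P.refMoment (P.beta α τ) ρ - τ)

/-- The derivative of `pathGradient`. -/
noncomputable def pathHessian (P : DelzantPolytope n N) (α : ℝ) (τ : EuclideanSpace ℝ (Fin n))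
    (s : ℝ) (φ : EuclideanSpace ℝ (Fin n) → ℝ) (ρ : EuclideanSpace ℝ (Fin n)) :
    EuclideanSpace ℝ (Fin n) →L[ℝ] EuclideanSpace ℝ (Fin n) :=
  s • fderiv ℝ (gradient φ) ρ + (α - s) • fderiv ℝ (P.refMoment (P.beta α τ)) ρ

namespace IsSolution

variable {P : DelzantPolytope n N} {α : ℝ} {τ c : EuclideanSpace ℝ (Fin n)} {s : ℝ}
  {φ : EuclideanSpace ℝ (Fin n) → ℝ}

theorem inner_gradient_sub_pos (h : IsSolution P α τ c s φ) {x y : EuclideanSpace ℝ (Fin n)}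
    (hxy : x ≠ y) : 0 < ⟪gradient φ y - gradient φ x, y - x⟫ :=
  inner_sub_pos_of_fderiv_pos (hasFDerivAt_gradient h.smooth)
    (inner_fderiv_gradient_pos h.smooth h.convex) hxy

theorem add_inner_le (h : IsSolution P α τ c s φ) (x y : EuclideanSpace ℝ (Fin n)) :
    φ x + ⟪gradient φ x, y - x⟫ ≤ φ y := by
  refine add_inner_le_of_monotone_gradient (hasGradientAt_of_contDiff h.smooth) (fun x y => ?_) x y
  rcases eq_or_ne x y with rfl | hxy
  · simp
  · exact (h.inner_gradient_sub_pos hxy).le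

theorem injective_gradient (h : IsSolution P α τ c s φ) : Function.Injective (gradient φ) := by
  intro x y hxy
  by_contra hne
  have := h.inner_gradient_sub_pos hne
  simp [hxy] at this

theorem gradient_mem (h : IsSolution P α τ c s φ) (ρ : EuclideanSpace ℝ (Fin n)) :
    gradient φ ρ ∈ P.carrier := h.gradient_range ▸ Set.mem_range_self ρ

theorem det_fderiv_gradient (h : IsSolution P α τ c s φ) (ρ : EuclideanSpace ℝ (Fin n)) :
    (fderiv ℝ (gradient φ) ρ).det =
      Real.exp (-pathPotential P α τ s φ ρ) * Real.exp (-⟪c, gradient φ ρ⟫) := by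
  have h1 : (fderiv ℝ (gradient φ) ρ).det = (hessian φ ρ).det := by
    rw [← toMatrix_fderiv_gradient h.smooth ρ, LinearMap.det_toMatrix]
  rw [h1, h.monge_ampere, ← Real.exp_add, pathPotential]
  congr 1
  ring

/-- The gradient map of a solution pushes `exp (-pathPotential)` forward to `exp (c · x)`. -/
theorem integral_comp_gradient (h : IsSolution P α τ c s φ) (f : EuclideanSpace ℝ (Fin n) → ℝ) :
    ∫ ρ, f (gradient φ ρ) * Real.exp (-pathPotential P α τ s φ ρ) =
      ∫ x in P.carrier, f x * Real.exp ⟪c, x⟫ := by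
  have h1 := integral_image_eq_integral_abs_det_fderiv_smul volume MeasurableSet.univ
    (fun ρ _ => (hasFDerivAt_gradient h.smooth ρ).hasFDerivWithinAt) h.injective_gradient.injOn
    (fun x => f x * Real.exp ⟪c, x⟫)
  rw [Set.image_univ, h.gradient_range, Measure.restrict_univ] at h1
  rw [h1]
  congr 1
  funext ρ
  rw [h.det_fderiv_gradient, abs_of_pos (by positivity), smul_eq_mul]
  have : Real.exp (-⟪c, gradient φ ρ⟫) * Real.exp ⟪c, gradient φ ρ⟫ = 1 := by
    rw [← Real.exp_add]; simp
  linear_combination (-f (gradient φ ρ) * Real.exp (-pathPotential P α τ s φ ρ)) * this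

end IsSolution

namespace DelzantPolytope.IsControlled

variable {P : DelzantPolytope n N} {α : ℝ} {τ c : EuclideanSpace ℝ (Fin n)}
  {s₀ ν σ Λ L δ K r : ℝ} {s : ℝ} {φ : EuclideanSpace ℝ (Fin n) → ℝ}

theorem le_beta (h : P.IsControlled α τ c s₀ ν σ Λ L δ K r) (hs₀ : 0 < s₀) (hδ : 0 < δ)
    (j : Fin N) : s₀ * δ ≤ P.beta α τ j :=
  mul_le_mul h.lt_alpha.le (h.le_l j) hδ.le (hs₀.trans h.lt_alpha).le

theorem beta_pos (h : P.IsControlled α τ c s₀ ν σ Λ L δ K r) (hs₀ : 0 < s₀) (hδ : 0 < δ)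
    (j : Fin N) : 0 < P.beta α τ j :=
  (mul_pos hs₀ hδ).trans_le (h.le_beta hs₀ hδ j)

theorem abs_inner_c_le (h : P.IsControlled α τ c s₀ ν σ Λ L δ K r) (hK : 0 < K)
    {x : EuclideanSpace ℝ (Fin n)} (hx : x ∈ P.carrier) : |⟪c, x⟫| ≤ K * σ :=
  (abs_real_inner_le_norm _ _).trans
    (mul_le_mul h.norm_c_le (h.norm_le x hx) (norm_nonneg _) hK.le)

/-- The exponent of the equation is a tame potential, with bounds that do not depend on `s`. The
Monge-Ampère lower bound holds because adding the Hessian of the reference potential increases the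
determinant. -/
theorem isTamePotential (h : P.IsControlled α τ c s₀ ν σ Λ L δ K r) (hs₀ : 0 < s₀) (hδ : 0 < δ)
    (hK : 0 < K) (hr : 0 < r) (hs : s ∈ Set.Ico s₀ α) (hφ : IsSolution P α τ c s φ) :
    IsTamePotential (pathPotential P α τ s φ) (pathGradient P α τ s φ) (pathHessian P α τ s φ)
      (2 * σ * K) (s₀ ^ n * Real.exp (-(K * σ))) := by
  have hβ := h.beta_pos hs₀ hδ
  have hs0 : 0 < s := hs₀.trans_le hs.1
  have hαs : 0 < α - s := sub_pos.mpr hs.2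
  have hσ : 0 ≤ σ := (norm_nonneg τ).trans (h.norm_le τ h.mem)
  have hsub : ∀ x ∈ P.carrier, ‖x - τ‖ ≤ 2 * σ := fun x hx => by
    have := norm_sub_le x τ
    linarith [h.norm_le x hx, h.norm_le τ h.mem]
  refine ⟨fun ρ => ?_, fun ρ => ?_, fun ρ ρ' => ?_, fun x y hxy => ?_, fun ρ => ?_, fun ρ => ?_, ?_⟩
  · have h1 := (hasGradientAt_of_contDiff hφ.smooth ρ).hasFDerivAt
    have h2 := (P.hasGradientAt_refPotential hβ ρ).hasFDerivAt
    have h3 : HasFDerivAt (fun ρ : EuclideanSpace ℝ (Fin n) => ⟪τ, ρ⟫) (innerSL ℝ τ) ρ :=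
      (innerSL ℝ τ).hasFDerivAt
    rw [hasGradientAt_iff_hasFDerivAt]
    refine (((h1.sub h3).const_mul s).add ((h2.sub h3).const_mul (α - s))).congr_fderiv ?_
    ext w
    simp [pathGradient]
  · have h1 := hasFDerivAt_gradient hφ.smooth ρ
    have h2 := (P.hasFDerivAt_refMoment hβ ρ).differentiableAt.hasFDerivAt
    exact ((h1.sub_const τ).const_smul s).add ((h2.sub_const τ).const_smul (α - s))
  · have h1 := mul_le_mul_of_nonneg_left (hφ.add_inner_le ρ ρ') hs0.le
    have h2 := mul_le_mul_of_nonneg_left (P.refPotential_add_inner_le hβ ρ ρ') hαs.le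
    simp only [pathPotential, pathGradient, inner_add_left, inner_smul_left, inner_sub_left,
      inner_sub_right, RCLike.conj_to_real] at *
    linarith
  · by_contra hne
    have h1 := mul_pos hs0 (hφ.inner_gradient_sub_pos hne)
    have h2 : 0 ≤ ⟪P.refMoment (P.beta α τ) y - P.refMoment (P.beta α τ) x, y - x⟫ := by
      have ha := P.refPotential_add_inner_le hβ x y
      have hb := P.refPotential_add_inner_le hβ y x
      rw [← neg_sub y x, inner_neg_right] at hb
      rw [inner_sub_left]
      linarith
    have h3 := mul_nonneg hαs.le h2
    have h4 : ⟪pathGradient P α τ s φ y - pathGradient P α τ s φ x, y - x⟫ = 0 := by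
      rw [hxy, sub_self, inner_zero_left]
    simp only [pathGradient, inner_add_left, inner_smul_left, inner_sub_left,
      RCLike.conj_to_real] at h1 h3 h4
    linarith
  · have h1 := hsub _ (hφ.gradient_mem ρ)
    have h2 := hsub _ (P.refMoment_mem hβ ρ)
    calc ‖pathGradient P α τ s φ ρ‖ ≤ s * (2 * σ) + (α - s) * (2 * σ) := by
          refine (norm_add_le _ _).trans ?_
          rw [norm_smul, norm_smul, Real.norm_of_nonneg hs0.le, Real.norm_of_nonneg hαs.le]
          gcongr
      _ = 2 * σ * α := by ring
      _ ≤ _ := by gcongr; exact h.alpha_le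
  · have hB : ((α - s) • fderiv ℝ (P.refMoment (P.beta α τ)) ρ).toLinearMap.IsPositive := by
      rw [(P.hasFDerivAt_refMoment hβ ρ).fderiv, ContinuousLinearMap.toLinearMap_smul]
      exact (P.isPositive_hessEquiv_symm hβ (P.refMoment_mem hβ ρ)).smul_of_nonneg hαs.le
    have hA : (LinearMap.toMatrix (EuclideanSpace.basisFun (Fin n) ℝ).toBasis
        (EuclideanSpace.basisFun (Fin n) ℝ).toBasis
        (s • fderiv ℝ (gradient φ) ρ).toLinearMap).PosDef := by
      rw [ContinuousLinearMap.toLinearMap_smul, map_smul, toMatrix_fderiv_gradient hφ.smooth]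
      exact (hφ.convex ρ).smul hs0
    have hdet := det_le_det_add_of_isPositive hA hB
    have hdets : (s • fderiv ℝ (gradient φ) ρ).det = s ^ n * (fderiv ℝ (gradient φ) ρ).det := by
      simp [ContinuousLinearMap.det]
    rw [hdets, hφ.det_fderiv_gradient] at hdet
    refine le_trans ?_ (hdet.trans (le_abs_self _))
    have h1 : Real.exp (-(K * σ)) ≤ Real.exp (-⟪c, gradient φ ρ⟫) := by
      gcongr
      exact (le_abs_self _).trans (h.abs_inner_c_le hK (hφ.gradient_mem ρ))
    have h2 : s₀ ^ n ≤ s ^ n := by gcongr; exact hs.1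
    calc _ = s₀ ^ n * (Real.exp (-pathPotential P α τ s φ ρ) * Real.exp (-(K * σ))) := by ring
      _ ≤ _ := by gcongr
  · obtain ⟨ρ₁, hρ₁⟩ : τ ∈ Set.range (gradient φ) := hφ.gradient_range ▸ h.mem
    refine ⟨(α - s) * r, mul_pos hαs hr, (α - s) * K - s * (φ ρ₁ - ⟪τ, ρ₁⟫), fun ρ => ?_⟩
    have h1 := hφ.add_inner_le ρ₁ ρ
    rw [hρ₁, inner_sub_right] at h1
    have h2 : r * ‖ρ‖ - K ≤ P.refPotential (P.beta α τ) ρ - ⟪τ, ρ⟫ := by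
      rcases eq_or_ne ρ 0 with rfl | hne
      · have h3 := P.inner_sub_refSymplectic_le_refPotential hβ h.mem 0
        have h4 := (le_abs_self _).trans (h.abs_refSymplectic_le τ h.mem)
        simp only [inner_zero_right, norm_zero] at *
        linarith
      · have hn : 0 < ‖ρ‖ := norm_pos_iff.mpr hne
        have hmem : τ + (r / ‖ρ‖) • ρ ∈ P.carrier := by
          refine h.ball_subset ?_
          rw [mem_closedBall_iff_norm, add_sub_cancel_left, norm_smul, norm_div, norm_norm,
            Real.norm_of_nonneg hr.le, div_mul_cancel₀ _ hn.ne']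
        have h3 := P.inner_sub_refSymplectic_le_refPotential hβ hmem ρ
        have h4 := (le_abs_self _).trans (h.abs_refSymplectic_le _ hmem)
        rw [inner_add_left, inner_smul_left, real_inner_self_eq_norm_sq] at h3
        have h5 : r / ‖ρ‖ * ‖ρ‖ ^ 2 = r * ‖ρ‖ := by field_simp
        simp only [RCLike.conj_to_real] at h3
        linarith
    have h3 := mul_le_mul_of_nonneg_left h1 hs0.le
    have h4 := mul_le_mul_of_nonneg_left h2 hαs.le
    rw [pathPotential]
    linarith

/-- The density `exp (-pathPotential)` has the mass of `exp (c · x)` on the polytope. -/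
theorem mass_bounds (h : P.IsControlled α τ c s₀ ν σ Λ L δ K r) (hK : 0 < K)
    (hφ : IsSolution P α τ c s φ) :
    Real.exp (-(K * σ)) * ν⁻¹ ≤ ∫ ρ, Real.exp (-pathPotential P α τ s φ ρ) ∧
      ∫ ρ, Real.exp (-pathPotential P α τ s φ ρ) ≤ Real.exp (K * σ) * ν := by
  have h1 := hφ.integral_comp_gradient fun _ => 1
  simp only [one_mul] at h1
  rw [h1]
  have hi : IntegrableOn (fun x => Real.exp ⟪c, x⟫) P.carrier :=
    P.integrableOn_carrier (by fun_prop)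
  have hconst : ∀ t : ℝ, ∫ _x in P.carrier, t = t * (volume P.carrier).toReal := fun t => by
    rw [setIntegral_const, smul_eq_mul, mul_comm]; rfl
  have hic : ∀ t : ℝ, IntegrableOn (fun _ : EuclideanSpace ℝ (Fin n) => t) P.carrier := fun t =>
    P.integrableOn_carrier continuous_const
  constructor
  · calc _ ≤ Real.exp (-(K * σ)) * (volume P.carrier).toReal := by
          gcongr; exact h.lt_volume.le
      _ = ∫ _x in P.carrier, Real.exp (-(K * σ)) := (hconst _).symm
      _ ≤ _ := by
          refine setIntegral_mono_on (hic _) hi P.measurableSet_carrier fun x hx => ?_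
          rw [Real.exp_le_exp]
          exact (abs_le.mp (h.abs_inner_c_le hK hx)).1
  · calc _ ≤ ∫ _x in P.carrier, Real.exp (K * σ) := by
          refine setIntegral_mono_on hi (hic _) P.measurableSet_carrier fun x hx => ?_
          rw [Real.exp_le_exp]
          exact (abs_le.mp (h.abs_inner_c_le hK hx)).2
      _ = Real.exp (K * σ) * (volume P.carrier).toReal := hconst _
      _ ≤ _ := by gcongr; exact h.volume_lt.le

/-- The barycenter condition for `c` and the vanishing of the mean of `pathGradient` together show
that `l j` along the reference moment map has mean `l j τ`. This is where `s < α` enters. -/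
theorem integral_l_refMoment (h : P.IsControlled α τ c s₀ ν σ Λ L δ K r) (hs₀ : 0 < s₀)
    (hδ : 0 < δ) (hK : 0 < K) (hr : 0 < r) (hs : s ∈ Set.Ico s₀ α) (hφ : IsSolution P α τ c s φ)
    (j : Fin N) :
    ∫ ρ, P.l j (P.refMoment (P.beta α τ) ρ) * Real.exp (-pathPotential P α τ s φ ρ) =
      P.l j τ * ∫ ρ, Real.exp (-pathPotential P α τ s φ ρ) := by
  have hβ := h.beta_pos hs₀ hδ
  have ht := h.isTamePotential hs₀ hδ hK hr hs hφ
  have hX : Continuous (P.refMoment (P.beta α τ)) :=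
    continuous_iff_continuousAt.mpr fun ρ => (P.hasFDerivAt_refMoment hβ ρ).continuousAt
  have hT : Continuous (gradient φ) :=
    continuous_iff_continuousAt.mpr fun ρ => (hasFDerivAt_gradient hφ.smooth ρ).continuousAt
  have hbd : ∀ x ∈ P.carrier, |⟪P.normal j, x - τ⟫| ≤ K * (2 * σ) := fun x hx => by
    refine (abs_real_inner_le_norm _ _).trans ?_
    have := norm_sub_le x τ
    exact mul_le_mul (h.norm_normal_le j)
      (by linarith [h.norm_le x hx, h.norm_le τ h.mem]) (norm_nonneg _) hK.le
  have hiT := ht.integrable_mul_exp_of_abs_le (f := fun ρ => ⟪P.normal j, gradient φ ρ - τ⟫)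
    (by fun_prop) (fun ρ => hbd _ (hφ.gradient_mem ρ))
  have hiX := ht.integrable_mul_exp_of_abs_le
    (f := fun ρ => ⟪P.normal j, P.refMoment (P.beta α τ) ρ - τ⟫)
    (by fun_prop) (fun ρ => hbd _ (P.refMoment_mem hβ ρ))
  have hT0 : ∫ ρ, ⟪P.normal j, gradient φ ρ - τ⟫ * Real.exp (-pathPotential P α τ s φ ρ) = 0 := by
    rw [hφ.integral_comp_gradient fun x => ⟪P.normal j, x - τ⟫]
    exact h.compatible.integral_inner_eq_zero _
  have hg0 := ht.integral_inner_gradient (P.normal j)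
  have e : ∀ ρ, ⟪pathGradient P α τ s φ ρ, P.normal j⟫ * Real.exp (-pathPotential P α τ s φ ρ) =
      s * (⟪P.normal j, gradient φ ρ - τ⟫ * Real.exp (-pathPotential P α τ s φ ρ)) + (α - s) *
      (⟪P.normal j, P.refMoment (P.beta α τ) ρ - τ⟫ * Real.exp (-pathPotential P α τ s φ ρ)) :=
    fun ρ => by
      rw [real_inner_comm, pathGradient, inner_add_right, inner_smul_right, inner_smul_right]; ring
  simp only [e] at hg0
  rw [integral_add (hiT.const_mul _) (hiX.const_mul _), integral_const_mul, integral_const_mul, hT0,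
    mul_zero, zero_add, mul_eq_zero, or_iff_right (sub_pos.mpr hs.2).ne'] at hg0
  have e2 : ∀ ρ, P.l j (P.refMoment (P.beta α τ) ρ) * Real.exp (-pathPotential P α τ s φ ρ) =
      ⟪P.normal j, P.refMoment (P.beta α τ) ρ - τ⟫ * Real.exp (-pathPotential P α τ s φ ρ) +
      P.l j τ * Real.exp (-pathPotential P α τ s φ ρ) := fun ρ => by
    rw [← P.l_sub]; ring
  simp only [e2]
  rw [integral_add hiX (ht.integrable_exp.const_mul _), hg0, zero_add, integral_const_mul]

end DelzantPolytope.IsControlled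

end Path

/-! ### Uniform estimates along the path -/

namespace DelzantPolytope.IsControlled

variable {n N : ℕ} {P : DelzantPolytope n N} {α : ℝ} {τ c : EuclideanSpace ℝ (Fin n)}
  {s₀ ν σ Λ L δ K r : ℝ} {s : ℝ} {φ : EuclideanSpace ℝ (Fin n) → ℝ}

/-- A point is the gradient of the reference symplectic potential at its image under the reference
moment map, so it is bounded when that image stays away from the facets. -/
theorem norm_le_of_le_l_refMoment (h : P.IsControlled α τ c s₀ ν σ Λ L δ K r) (hs₀ : 0 < s₀)
    (hδ : 0 < δ) (hK : 0 < K) {q : ℝ} (hq : 0 < q) {ρ : EuclideanSpace ℝ (Fin n)}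
    (hρ : ∀ j, q ≤ P.l j (P.refMoment (P.beta α τ) ρ)) :
    ‖ρ‖ ≤ K * ((1 + (|Real.log q| + |Real.log L|)) / (s₀ * δ) * K) := by
  have hβ := h.beta_pos hs₀ hδ
  have hx := P.refMoment_mem hβ ρ
  have hG := P.gradSymplectic_refMoment hβ ρ
  set x := P.refMoment (P.beta α τ) ρ
  rw [← hG]
  set B := (1 + (|Real.log q| + |Real.log L|)) / (s₀ * δ) * K with hB
  have hB0 : 0 ≤ B := by positivity
  refine (norm_sum_le _ _).trans ((Finset.sum_le_card_nsmul _ _ B fun j _ => ?_).trans ?_)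
  · rw [norm_smul, Real.norm_eq_abs, abs_div, abs_of_pos (hβ j)]
    have h1 : |1 + Real.log (P.l j x)| ≤ 1 + (|Real.log q| + |Real.log L|) := by
      have h2 := Real.log_le_log hq (hρ j)
      have h3 := Real.log_le_log (hx j) (h.l_le j x hx)
      have h4 := neg_abs_le (Real.log q)
      have h5 := le_abs_self (Real.log L)
      rw [abs_le]
      constructor <;> linarith [abs_nonneg (Real.log q), abs_nonneg (Real.log L)]
    have h2 := h.le_beta hs₀ hδ j
    have h3 := h.norm_normal_le j
    rw [hB]
    gcongr
  · simp only [Finset.card_univ, Fintype.card_fin, nsmul_eq_mul]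
    gcongr
    exact h.facets_le

/-- If `pathPotential` grows linearly away from `ρ₀`, then the mean of `l j` along the reference
moment map is almost attained near `ρ₀`. By the gradient bound the values of `l j` near `ρ₀` are
comparable to the value at `ρ₀`, which is therefore bounded below. -/
theorem le_l_refMoment (h : P.IsControlled α τ c s₀ ν σ Λ L δ K r) (hs₀ : 0 < s₀)
    (hδ : 0 < δ) (hK : 0 < K) (hr : 0 < r) (hL : 0 < L) (hs : s ∈ Set.Ico s₀ α)
    (hφ : IsSolution P α τ c s φ) {ε C A : ℝ} (hε : 0 < ε)
    {ρ₀ : EuclideanSpace ℝ (Fin n)}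
    (hgrow : ∀ ρ, ε * ‖ρ - ρ₀‖ - C ≤ pathPotential P α τ s φ ρ)
    (hsmall : L * Real.exp C * (Real.exp (-(ε / 2 * A)) *
      ∫ x : EuclideanSpace ℝ (Fin n), Real.exp (-(ε / 2 * ‖x‖))) ≤
      δ / 2 * (Real.exp (-(K * σ)) * ν⁻¹)) (j : Fin N) :
    δ / 2 * Real.exp (-(|Λ| * A)) ≤ P.l j (P.refMoment (P.beta α τ) ρ₀) := by
  have hβ := h.beta_pos hs₀ hδ
  have ht := h.isTamePotential hs₀ hδ hK hr hs hφ
  set W := pathPotential P α τ s φ with hW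
  set V := ∫ ρ, Real.exp (-W ρ) with hV
  have hV0 : 0 < V := integral_exp_pos ht.integrable_exp
  have hmean := h.integral_l_refMoment hs₀ hδ hK hr hs hφ j
  have hX : Continuous (P.refMoment (P.beta α τ)) :=
    continuous_iff_continuousAt.mpr fun ρ => (P.hasFDerivAt_refMoment hβ ρ).continuousAt
  set q := P.l j (P.refMoment (P.beta α τ) ρ₀) with hq
  have hq0 : 0 < q := P.refMoment_mem hβ ρ₀ j
  set D := {ρ : EuclideanSpace ℝ (Fin n) | A < ‖ρ - ρ₀‖} with hD
  have hmeas : MeasurableSet D := measurableSet_lt (by fun_prop) (by fun_prop)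
  have hlX : Continuous fun ρ => P.l j (P.refMoment (P.beta α τ) ρ) := (P.continuous_l j).comp hX
  have hi0 := ht.integrable_mul_exp_of_abs_le hlX (K := L) fun ρ => by
    have hx := P.refMoment_mem hβ ρ
    rw [abs_of_pos (hx j)]
    exact h.l_le j _ hx
  have hi1 := ht.integrable_exp.const_mul (q * Real.exp (|Λ| * A))
  have hi2 : Integrable (fun ρ => Real.exp C * Real.exp (-(ε * ‖ρ - ρ₀‖))) :=
    (integrable_exp_neg_mul_norm_sub hε ρ₀).const_mul _
  have hi3 : Integrable (D.indicator fun ρ => L * (Real.exp C * Real.exp (-(ε * ‖ρ - ρ₀‖)))) :=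
    (hi2.const_mul L).indicator hmeas
  have hupper : P.l j τ * V ≤ q * Real.exp (|Λ| * A) * V +
      L * Real.exp C * (Real.exp (-(ε / 2 * A)) *
        ∫ x : EuclideanSpace ℝ (Fin n), Real.exp (-(ε / 2 * ‖x‖))) := by
    rw [← hmean]
    calc _ ≤ ∫ ρ, (q * Real.exp (|Λ| * A) * Real.exp (-W ρ) +
          D.indicator (fun ρ => L * (Real.exp C * Real.exp (-(ε * ‖ρ - ρ₀‖)))) ρ) := by
          refine integral_mono hi0 (hi1.add hi3) fun ρ => ?_
          have hx := P.refMoment_mem hβ ρ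
          simp only
          by_cases hρ : ρ ∈ D
          · rw [Set.indicator_of_mem hρ, ← Real.exp_add]
            have h1 : P.l j (P.refMoment (P.beta α τ) ρ) * Real.exp (-W ρ) ≤
                L * Real.exp (C + -(ε * ‖ρ - ρ₀‖)) := by
              gcongr
              · exact h.l_le j _ hx
              · linarith [hgrow ρ]
            have h2 : 0 ≤ q * Real.exp (|Λ| * A) * Real.exp (-W ρ) := by positivity
            linarith
          · rw [Set.indicator_of_notMem hρ, add_zero]
            have hρA : ‖ρ - ρ₀‖ ≤ A := not_lt.mp hρ
            have h1 := h.gradientBound.l_refMoment_le hβ j ρ₀ ρ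
            have h2 : Λ * ‖ρ - ρ₀‖ ≤ |Λ| * A := by
              gcongr
              exact le_abs_self Λ
            gcongr
            refine h1.trans ?_
            gcongr
      _ = q * Real.exp (|Λ| * A) * V +
          L * (Real.exp C * ∫ ρ in D, Real.exp (-(ε * ‖ρ - ρ₀‖))) := by
          rw [integral_add hi1 hi3, integral_indicator hmeas, integral_const_mul,
            integral_const_mul, integral_const_mul]
      _ ≤ _ := by
          rw [mul_assoc L]
          gcongr
          exact setIntegral_exp_neg_mul_norm_le hε ρ₀
  have h1 : δ * V ≤ P.l j τ * V := by gcongr; exact h.le_l j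
  have h2 : δ / 2 * (Real.exp (-(K * σ)) * ν⁻¹) ≤ δ / 2 * V := by
    gcongr
    exact (h.mass_bounds hK hφ).1
  have h3 : δ / 2 * V ≤ q * Real.exp (|Λ| * A) * V := by linarith
  have h4 := le_of_mul_le_mul_right h3 hV0
  rw [Real.exp_neg, ← div_eq_mul_inv, div_le_iff₀ (Real.exp_pos _)]
  exact h4

/-- A bound for `pathPotential` at `ρ₀` bounds the solution at `ρ₀`, because `s` is bounded below,
and then at the origin, because the gradient of the solution is bounded. -/
theorem abs_apply_zero_le (h : P.IsControlled α τ c s₀ ν σ Λ L δ K r) (hs₀ : 0 < s₀)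
    (hδ : 0 < δ) (hs : s ∈ Set.Ico s₀ α)
    (hφ : IsSolution P α τ c s φ) {C R : ℝ} {ρ₀ : EuclideanSpace ℝ (Fin n)}
    (hW : |pathPotential P α τ s φ ρ₀| ≤ C) (hρ₀ : ‖ρ₀‖ ≤ R) :
    |φ 0| ≤ (C + K * (2 * (σ * R) + K)) / s₀ + 2 * (σ * R) := by
  have hβ := h.beta_pos hs₀ hδ
  have hs0 : 0 < s := hs₀.trans_le hs.1
  have hinner : ∀ x ∈ P.carrier, |⟪x, ρ₀⟫| ≤ σ * R := fun x hx =>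
    (abs_real_inner_le_norm _ _).trans (mul_le_mul (h.norm_le x hx) hρ₀ (norm_nonneg _)
      ((norm_nonneg _).trans (h.norm_le x hx)))
  have h1 : |P.refPotential (P.beta α τ) ρ₀ - ⟪τ, ρ₀⟫| ≤ 2 * (σ * R) + K := by
    have hx := P.refMoment_mem hβ ρ₀
    have ha := abs_le.mp (hinner _ hx)
    have hb := abs_le.mp (hinner _ h.mem)
    have hc := abs_le.mp (h.abs_refSymplectic_le _ hx)
    rw [P.refPotential_eq hβ, abs_le]
    constructor <;> linarith [ha.1, ha.2, hb.1, hb.2, hc.1, hc.2]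
  have h2 : |φ ρ₀ - ⟪τ, ρ₀⟫| ≤ (C + K * (2 * (σ * R) + K)) / s₀ := by
    rw [le_div_iff₀ hs₀]
    have e : s * (φ ρ₀ - ⟪τ, ρ₀⟫) = pathPotential P α τ s φ ρ₀ -
        (α - s) * (P.refPotential (P.beta α τ) ρ₀ - ⟪τ, ρ₀⟫) := by
      rw [pathPotential]; ring
    have h3 : |(α - s) * (P.refPotential (P.beta α τ) ρ₀ - ⟪τ, ρ₀⟫)| ≤
        K * (2 * (σ * R) + K) := by
      have hαs : 0 < α - s := sub_pos.mpr hs.2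
      rw [abs_mul, abs_of_pos hαs]
      have hK' : α - s ≤ K := by linarith [h.alpha_le]
      gcongr
      exact hαs.le.trans hK'
    calc |φ ρ₀ - ⟪τ, ρ₀⟫| * s₀ ≤ |φ ρ₀ - ⟪τ, ρ₀⟫| * s := by gcongr; exact hs.1
      _ = |s * (φ ρ₀ - ⟪τ, ρ₀⟫)| := by rw [abs_mul, abs_of_pos hs0, mul_comm]
      _ ≤ _ := by
        rw [e]
        refine (abs_sub _ _).trans ?_
        linarith
  have h3 := hφ.add_inner_le 0 ρ₀
  have h4 := hφ.add_inner_le ρ₀ 0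
  rw [sub_zero] at h3
  rw [zero_sub, inner_neg_right] at h4
  have h5 := abs_le.mp (hinner _ (hφ.gradient_mem 0))
  have h6 := abs_le.mp (hinner _ (hφ.gradient_mem ρ₀))
  have h7 := abs_le.mp (hinner _ h.mem)
  have h8 := abs_le.mp h2
  rw [abs_le]
  constructor <;> linarith [h5.1, h5.2, h6.1, h6.2, h7.1, h7.2, h8.1, h8.2]

end DelzantPolytope.IsControlled

/-- Along the path the exponent of the equation grows linearly and the solution is bounded at the
origin, with constants that depend only on the bounds. -/
theorem exists_path_growth (n : ℕ) {s₀ ν σ Λ L δ K r : ℝ} (hs₀ : 0 < s₀) (hν : 0 < ν)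
    (hσ : 0 < σ) (hL : 0 < L) (hδ : 0 < δ) (hK : 0 < K) (hr : 0 < r) :
    ∃ ε > 0, ∃ C : ℝ, ∀ (N : ℕ) (P : DelzantPolytope n N) (α : ℝ)
      (τ c : EuclideanSpace ℝ (Fin n)) (s : ℝ) (φ : EuclideanSpace ℝ (Fin n) → ℝ),
      P.IsControlled α τ c s₀ ν σ Λ L δ K r → s ∈ Set.Ico s₀ α → IsSolution P α τ c s φ →
      |φ 0| ≤ C ∧ ∀ ρ, ε * ‖ρ‖ - C ≤ pathPotential P α τ s φ ρ := by
  obtain ⟨ε, hε, C, hC, hcore⟩ := exists_linear_growth (E := EuclideanSpace ℝ (Fin n))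
    (M := 2 * σ * K) (c₀ := s₀ ^ n * Real.exp (-(K * σ))) (V₀ := Real.exp (-(K * σ)) * ν⁻¹)
    (V₁ := Real.exp (K * σ) * ν) (by positivity) (by positivity) (by positivity) (by positivity)
  set I := ∫ x : EuclideanSpace ℝ (Fin n), Real.exp (-(ε / 2 * ‖x‖)) with hI
  have hI0 : 0 < I := integral_exp_neg_mul_norm_pos (half_pos hε)
  set V₀ := Real.exp (-(K * σ)) * ν⁻¹ with hV₀
  have hV₀0 : 0 < V₀ := by positivity
  set t := L * Real.exp C * I / (δ / 2 * V₀) with ht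
  have ht0 : 0 < t := by positivity
  -- The radius `A` makes the tail of the density beyond distance `A` negligible.
  set A := 2 / ε * |Real.log t| with hA
  have hA0 : 0 ≤ A := by positivity
  have hsmall : L * Real.exp C * (Real.exp (-(ε / 2 * A)) * I) ≤ δ / 2 * V₀ := by
    have h1 : Real.exp (-(ε / 2 * A)) ≤ t⁻¹ := by
      have e : ε / 2 * A = |Real.log t| := by rw [hA]; field_simp
      rw [e, ← Real.exp_log (inv_pos.mpr ht0), Real.exp_le_exp, Real.log_inv, neg_le_neg_iff]
      exact le_abs_self _
    calc _ ≤ L * Real.exp C * (t⁻¹ * I) := by gcongr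
      _ = _ := by rw [ht]; field_simp
  set q := δ / 2 * Real.exp (-(|Λ| * A)) with hq
  have hq0 : 0 < q := by positivity
  set R := K * ((1 + (|Real.log q| + |Real.log L|)) / (s₀ * δ) * K) with hR
  have hR0 : 0 ≤ R := by positivity
  set C₀ := (C + K * (2 * (σ * R) + K)) / s₀ + 2 * (σ * R) with hC₀
  have hC₀0 : 0 ≤ C₀ := by positivity
  refine ⟨ε, hε, C₀ + (C + ε * R), ?_⟩
  intro N P α τ c s φ h hs hφ
  obtain ⟨hV0, hV1⟩ := h.mass_bounds hK hφ
  obtain ⟨ρ₀, hmin, hgrow⟩ := hcore _ _ _ (h.isTamePotential hs₀ hδ hK hr hs hφ) hV0 hV1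
  have hρ₀ : ‖ρ₀‖ ≤ R := h.norm_le_of_le_l_refMoment hs₀ hδ hK hq0 fun j =>
    h.le_l_refMoment hs₀ hδ hK hr hL hs hφ hε hgrow hsmall j
  have hεR : 0 ≤ ε * R := by positivity
  refine ⟨(h.abs_apply_zero_le hs₀ hδ hs hφ hmin hρ₀).trans (by linarith), fun ρ => ?_⟩
  have h1 := norm_sub_norm_le ρ ρ₀
  have h2 : ε * (‖ρ‖ - R) ≤ ε * ‖ρ - ρ₀‖ := by
    gcongr
    linarith
  linarith [hgrow ρ]

/-- Linear growth of the exponent makes the gradient image of the complement of a large ball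
exponentially small. -/
theorem DelzantPolytope.IsControlled.volume_image_gradient_le {n N : ℕ} {P : DelzantPolytope n N}
    {α : ℝ} {τ c : EuclideanSpace ℝ (Fin n)} {s₀ ν σ Λ L δ K r s : ℝ}
    {φ : EuclideanSpace ℝ (Fin n) → ℝ} (h : P.IsControlled α τ c s₀ ν σ Λ L δ K r) (hK : 0 < K)
    (hφ : IsSolution P α τ c s φ) {ε C : ℝ} (hε : 0 < ε)
    (hgrow : ∀ ρ, ε * ‖ρ‖ - C ≤ pathPotential P α τ s φ ρ) (R : ℝ) :
    volume (gradient φ '' {ρ | R < ‖ρ‖}) ≤ ENNReal.ofReal (Real.exp (K * σ + C) *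
      (∫ x : EuclideanSpace ℝ (Fin n), Real.exp (-(ε / 2 * ‖x‖))) * Real.exp (-(ε / 2 * R))) := by
  have hmeas : MeasurableSet {ρ : EuclideanSpace ℝ (Fin n) | R < ‖ρ‖} :=
    measurableSet_lt (by fun_prop) (by fun_prop)
  have hi : Integrable (fun ρ : EuclideanSpace ℝ (Fin n) =>
      Real.exp (K * σ + C) * Real.exp (-(ε * ‖ρ‖))) :=
    (integrable_exp_neg_mul_norm hε).const_mul _
  calc _ ≤ ∫⁻ ρ in {ρ | R < ‖ρ‖}, ENNReal.ofReal |(fderiv ℝ (gradient φ) ρ).det| :=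
        addHaar_image_le_lintegral_abs_det_fderiv volume hmeas
          fun ρ _ => (hasFDerivAt_gradient hφ.smooth ρ).hasFDerivWithinAt
    _ ≤ ∫⁻ ρ in {ρ : EuclideanSpace ℝ (Fin n) | R < ‖ρ‖},
        ENNReal.ofReal (Real.exp (K * σ + C) * Real.exp (-(ε * ‖ρ‖))) := by
        refine lintegral_mono fun ρ => ENNReal.ofReal_le_ofReal ?_
        rw [hφ.det_fderiv_gradient, abs_of_pos (by positivity), ← Real.exp_add, ← Real.exp_add,
          Real.exp_le_exp]
        linarith [hgrow ρ, (abs_le.mp (h.abs_inner_c_le hK (hφ.gradient_mem ρ))).1]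
    _ = ENNReal.ofReal (∫ ρ in {ρ : EuclideanSpace ℝ (Fin n) | R < ‖ρ‖},
        Real.exp (K * σ + C) * Real.exp (-(ε * ‖ρ‖))) :=
        (ofReal_integral_eq_lintegral_ofReal hi.integrableOn
          (Filter.Eventually.of_forall fun ρ => by positivity)).symm
    _ ≤ _ := by
        refine ENNReal.ofReal_le_ofReal ?_
        rw [integral_const_mul, mul_assoc, mul_comm (∫ x : EuclideanSpace ℝ (Fin n), _)]
        gcongr
        simpa using setIntegral_exp_neg_mul_norm_le (R := R) hε (0 : EuclideanSpace ℝ (Fin n))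

/-- The uniform estimate for controlled data. -/
theorem exists_abs_sub_refPotential_le (n : ℕ) {s₀ ν σ Λ L δ K r : ℝ} (hs₀ : 0 < s₀) (hν : 0 < ν)
    (hσ : 0 < σ) (hL : 0 < L) (hδ : 0 < δ) (hK : 0 < K) (hr : 0 < r) :
    ∃ C : ℝ, ∀ (N : ℕ) (P : DelzantPolytope n N) (α : ℝ)
      (τ c : EuclideanSpace ℝ (Fin n)) (s : ℝ) (φ : EuclideanSpace ℝ (Fin n) → ℝ),
      P.IsControlled α τ c s₀ ν σ Λ L δ K r → s ∈ Set.Ico s₀ α → IsSolution P α τ c s φ →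
      ∀ ρ, |φ ρ - P.refPotential (P.beta α τ) ρ| ≤ C := by
  obtain ⟨ε, hε, C, hgrowth⟩ := exists_path_growth n (Λ := Λ) hs₀ hν hσ hL hδ hK hr
  obtain ⟨C₁, hC₁⟩ := exists_legendre_le (E := EuclideanSpace ℝ (Fin n)) (a := ε / 2) (C₀ := C)
    (C₁ := Real.exp (K * σ + C) *
      ∫ x : EuclideanSpace ℝ (Fin n), Real.exp (-(ε / 2 * ‖x‖))) (v₀ := ν⁻¹) (σ := σ)
    (half_pos hε) (mul_nonneg (Real.exp_pos _).le (integral_nonneg fun x => (Real.exp_pos _).le))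
    (inv_pos.mpr hν) hσ.le
  refine ⟨|C| + |C₁| + K, ?_⟩
  intro N P α τ c s φ h hs hφ ρ
  obtain ⟨h0, hgrow⟩ := hgrowth N P α τ c s φ h hs hφ
  have hβ := h.beta_pos hs₀ hδ
  have hvol : ENNReal.ofReal ν⁻¹ ≤ volume P.carrier :=
    ENNReal.ofReal_le_of_le_toReal h.lt_volume.le
  have hleg := hC₁ φ (gradient φ) P.carrier hφ.gradient_range P.convex_carrier hvol h.norm_le
    hφ.add_inner_le (h.volume_image_gradient_le hK hφ hε hgrow) h0
  rw [abs_le]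
  constructor
  · have hx := P.refMoment_mem hβ ρ
    have h1 := hleg _ hx ρ
    have h2 := (abs_le.mp (h.abs_refSymplectic_le _ hx)).1
    rw [P.refPotential_eq hβ]
    linarith [le_abs_self C₁, abs_nonneg C]
  · have hx := hφ.gradient_mem ρ
    have h1 := hφ.add_inner_le ρ 0
    rw [zero_sub, inner_neg_right] at h1
    have h2 := P.inner_sub_refSymplectic_le_refPotential hβ hx ρ
    have h3 := (abs_le.mp (h.abs_refSymplectic_le _ hx)).2
    linarith [(abs_le.mp h0).2, le_abs_self C, abs_nonneg C₁]

end ToricMA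

theorem mainTheorem5 (n : ℕ) :
    (∀ (N : ℕ) (P : ToricMA.DelzantPolytope n N) (α : ℝ) (τ : EuclideanSpace ℝ (Fin n)),
      0 < α → τ ∈ P.carrier → (∀ j, 0 < 1 - α * P.l j τ) →
      ∃ Λ : ℝ, P.IsGradientBound (P.beta α τ) Λ) ∧
    ∀ (s₀ ν σ Λ L δ : ℝ), 0 < s₀ → 0 < δ →
      ∃ C : ℝ, ∀ (N : ℕ) (P : ToricMA.DelzantPolytope n N) (α : ℝ)
        (τ c : EuclideanSpace ℝ (Fin n)),
        s₀ < α → τ ∈ P.carrier → (∀ j, 0 < 1 - α * P.l j τ) → P.IsCompatible τ c →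
        ν⁻¹ < (volume P.carrier).toReal → (volume P.carrier).toReal < ν →
        σ⁻¹ < Metric.diam P.carrier → Metric.diam P.carrier < σ →
        (∀ x ∈ P.carrier, ‖x‖ ≤ σ) →
        (∀ j, ∀ x ∈ P.carrier, |P.l j x| ≤ L) →
        (∀ j, δ ≤ P.l j τ) →
        P.IsGradientBound (P.beta α τ) Λ →
        ∀ s ∈ Set.Ico s₀ α, ∀ φ : EuclideanSpace ℝ (Fin n) → ℝ,
          ToricMA.IsSolution P α τ c s φ →
          ∀ ρ, |φ ρ - P.refPotential (P.beta α τ) ρ| ≤ C := by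
  refine ⟨fun N P α τ hα hτ _ => P.exists_isGradientBound fun j => mul_pos hα (hτ j), ?_⟩
  intro s₀ ν σ Λ L δ hs₀ hδ
  -- The other constants are positive as soon as there is a polytope that satisfies the bounds.
  by_cases hpos : 0 < ν ∧ 0 < σ ∧ 0 < L
  · obtain ⟨hν, hσ, hL⟩ := hpos
    obtain ⟨K, hK, r, hr, hcontrol⟩ :=
      ToricMA.DelzantPolytope.exists_isControlled n hs₀ hν hσ hL hδ
    obtain ⟨C, hC⟩ :=
      ToricMA.exists_abs_sub_refPotential_le n (Λ := Λ) hs₀ hν hσ hL hδ hK hr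
    refine ⟨C, fun N P α τ c hα hτ hone hcomp hv1 hv2 hd1 _ hbd hl hτδ hΛ s hs φ hφ => ?_⟩
    exact hC N P α τ c s φ (hcontrol N P α τ c Λ hα hτ hone hcomp hv1 hv2
      ((inv_pos.mpr hσ).trans hd1) hbd hl hτδ hΛ) hs hφ
  · refine ⟨0, fun N P α τ c hα hτ hone hcomp hv1 hv2 hd1 hd2 hbd hl hτδ hΛ => ?_⟩
    refine absurd ?_ hpos
    have hσ : 0 < σ := Metric.diam_nonneg.trans_lt hd2
    obtain ⟨j⟩ := P.nonempty_facets_of_diam_pos ((inv_pos.mpr hσ).trans hd1)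
    exact ⟨ENNReal.toReal_nonneg.trans_lt hv2, hσ, hδ.trans_le ((hτδ j).trans
      ((le_abs_self _).trans (hl j τ hτ)))⟩
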